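/- Let $\mathcal A$ be a $W^*$-algebra and let $$H_{\mathcal A}=\Big\{x=(x_i)_{i\in\mathbb N} : x_i\in\mathcal A,\ \sum_i x_i^*x_i \text{ converges in norm}\Big\}$$ be the standard right Hilbert $\mathcal A$-module, with inner product $\langle x,y\rangle=\sum_i x_i^*y_i$ and norm $\|x\|=\|\langle x,x\rangle\|^{1/2}$. A bounded $\mathcal A$-linear operator $F$ on $H_{\mathcal A}$ is adjointable if there is a bounded $\mathcal A$-linear operator $F^*$ with $\langle Fx,y\rangle=\langle x,F^*y\rangle$ for all $x,y\in H_{\mathcal A}$. An adjointable operator is compact (in the sense of Hilbert $C^*$-modules) if it lies in the operator-norm closure of the set of finite sums of operators $\theta_{x,y}\colon z\mapsto x\langle y,z\rangle$ with $x,y\in H_{\mathcal A}$; let $K^*(H_{\mathcal A})$ denote the set of these operators. A submodule of $H_{\mathcal A}$ is finitely generated if it is the (algebraic) $\mathcal A$-linear span of a finite subset. An adjointable operator $F$ is upper semi-$\mathcal A$-Fredholm if there are closed submodules $M_1,N_1,M_2,N_2$ of $H_{\mathcal A}$ such that $H_{\mathcal A}=M_1\,\tilde\oplus\,N_1=M_2\,\tilde\oplus\,N_2$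 (direct sums, not necessarily orthogonal), $F$ restricts to an isomorphism of $M_1$ onto $M_2$, $F(N_1)\subseteq N_2$, and $N_1$ is finitely generated. **Theorem.** Let $F$ be an adjointable operator on $H_{\mathcal A}$. Then $F$ is upper semi-$\mathcal A$-Fredholm if and only if $\ker(F-K)$ is finitely generated for every $K\in K^*(H_{\mathcal A})$. -/

import Mathlib

open MulOpposite

noncomputable section

namespace HilbertModule

section Summability

variable {A : Type*} [CStarAlgebra A]

theorem summable_of_nonneg_of_le [PartialOrder A] [StarOrderedRing A] {f g : ℕ → A}
    (h0 : ∀ i, 0 ≤ f i) (hfg : ∀ i, f i ≤ g i) (hg : Summable g) : Summable f := by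
  rw [summable_iff_vanishing_norm] at hg ⊢
  intro ε hε
  obtain ⟨s, hs⟩ := hg ε hε
  exact ⟨s, fun t ht => lt_of_le_of_lt (CStarAlgebra.norm_le_norm_of_nonneg_of_le
    (Finset.sum_nonneg fun i _ => h0 i) (Finset.sum_le_sum fun i _ => hfg i)) (hs t ht)⟩

theorem summable_star_mul_self_add {x y : ℕ → A} (hx : Summable fun i => star (x i) * x i)
    (hy : Summable fun i => star (y i) * y i) :
    Summable fun i => star (x i + y i) * (x i + y i) := by
  let _ := CStarAlgebra.spectralOrder A
  have _ := CStarAlgebra.spectralOrderedRing A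
  refine summable_of_nonneg_of_le (fun i => star_mul_self_nonneg _) (fun i => ?_)
    ((hx.add hy).add (hx.add hy))
  rw [← sub_nonneg]
  convert star_mul_self_nonneg (x i - y i) using 1
  simp only [star_add, star_sub]
  noncomm_ring

theorem summable_star_mul_self_mul_right {x : ℕ → A} (hx : Summable fun i => star (x i) * x i)
    (a : A) : Summable fun i => star (x i * a) * (x i * a) := by
  have := (hx.mul_left (star a)).mul_right a
  simpa only [star_mul, mul_assoc] using this

theorem summable_star_mul {x y : ℕ → A} (hx : Summable fun i => star (x i) * x i)
    (hy : Summable fun i => star (y i) * y i) : Summable fun i => star (x i) * y i := by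
  have h1 := ((summable_star_mul_self_add hx hy).sub hx).sub hy
  have hy' : Summable fun i => star (Complex.I • y i) * (Complex.I • y i) := by
    refine hy.congr fun i => ?_
    simp [smul_smul]
  have h2 := (((summable_star_mul_self_add hx hy').sub hx).sub hy').const_smul (-Complex.I)
  refine ((h1.add h2).const_smul (1 / 2 : ℂ)).congr fun i => ?_
  simp only [star_add, star_smul, add_mul, mul_add, smul_mul_assoc, mul_smul_comm, smul_add,
    smul_sub, smul_smul, Complex.star_def, Complex.conj_I]
  match_scalars <;> ring_nf <;> simp only [Complex.I_sq] <;> ring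

end Summability

/-- The sequences `x` in `A` for which `∑ xᵢ* xᵢ` converges in norm, with the right action of `A`
(written, as usual in Mathlib, as an action of `Aᵐᵒᵖ`: `(op a • x) i = x i * a`). -/
def stdSubmodule (A : Type*) [CStarAlgebra A] : Submodule Aᵐᵒᵖ (ℕ → A) where
  carrier := {x | Summable fun i => star (x i) * x i}
  add_mem' hx hy := summable_star_mul_self_add hx hy
  zero_mem' := by simp [summable_zero]
  smul_mem' a _ hx := summable_star_mul_self_mul_right hx (unop a)

/-- The standard Hilbert module `H_A = ℓ²(A)`, a right Hilbert module over `A`. -/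
def Std (A : Type*) [CStarAlgebra A] : Type _ := stdSubmodule A

namespace Std

variable {A : Type*} [CStarAlgebra A]

instance : AddCommGroup (Std A) := inferInstanceAs (AddCommGroup (stdSubmodule A))

instance : Module Aᵐᵒᵖ (Std A) := inferInstanceAs (Module Aᵐᵒᵖ (stdSubmodule A))

instance : Module ℂ (Std A) := inferInstanceAs (Module ℂ (stdSubmodule A))

instance : IsScalarTower ℂ Aᵐᵒᵖ (Std A) :=
  inferInstanceAs (IsScalarTower ℂ Aᵐᵒᵖ (stdSubmodule A))

instance : SMulCommClass ℂ Aᵐᵒᵖ (Std A) :=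
  inferInstanceAs (SMulCommClass ℂ Aᵐᵒᵖ (stdSubmodule A))

instance : CoeFun (Std A) fun _ => ℕ → A := ⟨fun x => x.1⟩

@[ext] theorem ext {x y : Std A} (h : ∀ i, x i = y i) : x = y := Subtype.ext (funext h)

@[simp] theorem add_apply (x y : Std A) (i : ℕ) : (x + y) i = x i + y i := rfl

@[simp] theorem zero_apply (i : ℕ) : (0 : Std A) i = 0 := rfl

@[simp] theorem op_smul_apply (a : Aᵐᵒᵖ) (x : Std A) (i : ℕ) : (a • x) i = x i * unop a := rfl

@[simp] theorem complex_smul_apply (z : ℂ) (x : Std A) (i : ℕ) : (z • x) i = z • x i := rfl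

/-- The `A`-valued inner product `⟨x, y⟩ = ∑ xᵢ* yᵢ`, conjugate linear in the first variable and
`A`-linear in the second. -/
def ip (x y : Std A) : A := ∑' i, star (x i) * y i

theorem summable_ip (x y : Std A) : Summable fun i => star (x i) * y i :=
  summable_star_mul x.2 y.2

theorem ip_add_right (x y z : Std A) : ip x (y + z) = ip x y + ip x z := by
  simp only [ip, add_apply, mul_add]
  exact (summable_ip x y).tsum_add (summable_ip x z)

theorem ip_op_smul_right (x y : Std A) (a : Aᵐᵒᵖ) : ip x (a • y) = ip x y * unop a := by
  simp only [ip, op_smul_apply, ← mul_assoc]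
  exact (summable_ip x y).tsum_mul_right _

theorem ip_smul_right (x y : Std A) (z : ℂ) : ip x (z • y) = z • ip x y := by
  simp only [ip, complex_smul_apply, mul_smul_comm]
  exact (summable_ip x y).tsum_const_smul z

theorem star_ip (x y : Std A) : star (ip x y) = ip y x := by
  simp [ip, tsum_star]

theorem ip_self_nonneg [PartialOrder A] [StarOrderedRing A] (x : Std A) : 0 ≤ ip x x :=
  tsum_nonneg fun _ => star_mul_self_nonneg _

theorem ip_self_eq_zero {x : Std A} : ip x x = 0 ↔ x = 0 := by
  let _ := CStarAlgebra.spectralOrder A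
  have _ := CStarAlgebra.spectralOrderedRing A
  refine ⟨fun h => ?_, fun h => by simp [h, ip]⟩
  ext i
  have h1 : star (x i) * x i ≤ ip x x :=
    (summable_ip x x).le_tsum i fun _ _ => star_mul_self_nonneg _
  rw [h] at h1
  exact (CStarRing.star_mul_self_eq_zero_iff _).1 (le_antisymm h1 (star_mul_self_nonneg _))

/-- The norm `‖x‖ = ‖⟨x, x⟩‖^(1/2)`. -/
instance : Norm (Std A) := ⟨fun x => √‖ip x x‖⟩

theorem norm_def (x : Std A) : ‖x‖ = √‖ip x x‖ := rfl

/-- `H_A` satisfies Mathlib's axioms of a Hilbert C⋆-module. Mathlib's class is written for left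
modules; a right `A`-module is a left `Aᵐᵒᵖ`-module. -/
@[reducible] def cstarModule [PartialOrder Aᵐᵒᵖ] [StarOrderedRing Aᵐᵒᵖ] :
    CStarModule Aᵐᵒᵖ (Std A) where
  inner x y := op (ip x y)
  inner_add_right {x y z} := by rw [ip_add_right, op_add]
  inner_self_nonneg {x} := by
    rw [ip, ← tsum_op]
    exact tsum_nonneg fun i => by
      simpa only [op_mul, op_star] using mul_star_self_nonneg (op (x i))
  inner_self {x} := by rw [op_eq_zero_iff, ip_self_eq_zero]
  inner_op_smul_right {a x y} := by rw [ip_op_smul_right, op_mul, op_unop]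
  inner_smul_right_complex {z x y} := by rw [ip_smul_right, op_smul]
  star_inner x y := by rw [← op_star, star_ip]
  norm_eq_sqrt_norm_inner_self x := by rw [norm_op, norm_def]

theorem normedSpaceCore : NormedSpace.Core ℂ (Std A) := by
  let _ := CStarAlgebra.spectralOrder Aᵐᵒᵖ
  have _ := CStarAlgebra.spectralOrderedRing Aᵐᵒᵖ
  let _ := cstarModule (A := A)
  exact CStarModule.normedSpaceCore Aᵐᵒᵖ

instance : NormedAddCommGroup (Std A) := NormedAddCommGroup.ofCore normedSpaceCore

instance : NormedSpace ℂ (Std A) := NormedSpace.ofCore normedSpaceCore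

theorem norm_ip_le (x y : Std A) : ‖ip x y‖ ≤ ‖x‖ * ‖y‖ := by
  let _ := CStarAlgebra.spectralOrder Aᵐᵒᵖ
  have _ := CStarAlgebra.spectralOrderedRing Aᵐᵒᵖ
  let _ := cstarModule (A := A)
  exact CStarModule.norm_inner_le (A := Aᵐᵒᵖ) (Std A)

theorem norm_sq_eq (x : Std A) : ‖x‖ ^ 2 = ‖ip x x‖ := Real.sq_sqrt (norm_nonneg _)

theorem norm_op_smul_le (a : Aᵐᵒᵖ) (x : Std A) : ‖a • x‖ ≤ ‖a‖ * ‖x‖ := by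
  refine le_of_sq_le_sq ?_ (by positivity)
  have h : ip (a • x) (a • x) = star (unop a) * ip x x * unop a := by
    rw [ip_op_smul_right, ← star_ip, ip_op_smul_right, star_mul, star_ip]
  rw [norm_sq_eq, h, mul_pow, norm_sq_eq]
  calc ‖star (unop a) * ip x x * unop a‖ ≤ ‖star (unop a)‖ * ‖ip x x‖ * ‖unop a‖ :=
        (norm_mul_le _ _).trans (by gcongr; exact norm_mul_le _ _)
    _ = ‖a‖ ^ 2 * ‖ip x x‖ := by rw [norm_star, norm_unop]; ring

end Std

section Operators

variable {A : Type*} [CStarAlgebra A]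

/-- The elementary operator `θ_{x,y} : z ↦ x ⟨y, z⟩` on `H_A`. -/
def rankOne (x y : Std A) : Std A →L[Aᵐᵒᵖ] Std A where
  toFun z := op (Std.ip y z) • x
  map_add' z w := by rw [Std.ip_add_right, op_add, add_smul]
  map_smul' a z := by rw [Std.ip_op_smul_right, op_mul, op_unop, RingHom.id_apply, mul_smul]
  cont := by
    let f : Std A →+ Std A :=
      { toFun := fun z => op (Std.ip y z) • x
        map_zero' := by simp [Std.ip]
        map_add' := fun z w => by rw [Std.ip_add_right, op_add, add_smul] }
    refine AddMonoidHomClass.continuous_of_bound f (‖y‖ * ‖x‖) fun z => ?_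
    calc ‖op (Std.ip y z) • x‖ ≤ ‖op (Std.ip y z)‖ * ‖x‖ := Std.norm_op_smul_le _ _
      _ ≤ (‖y‖ * ‖z‖) * ‖x‖ := by rw [norm_op]; gcongr; exact Std.norm_ip_le y z
      _ = ‖y‖ * ‖x‖ * ‖z‖ := by ring

/-- A bounded `A`-linear operator `F` on `H_A` is adjointable, `F ∈ B^a(H_A)`, if there is an
operator `F*` with `⟨F x, y⟩ = ⟨x, F* y⟩` for all `x, y`. -/
def IsAdjointable (F : Std A →L[Aᵐᵒᵖ] Std A) : Prop :=
  ∃ G : Std A →L[Aᵐᵒᵖ] Std A, ∀ x y, Std.ip (F x) y = Std.ip x (G y)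

/-- The adjointable compact operators `K*(H_A)`: the adjointable operators that lie in the closure,
in the operator norm, of the finite sums of elementary operators `θ_{x,y}`. The condition
`∀ z, ‖K z - T z‖ ≤ ε * ‖z‖` says that the operator norm of `K - T` is at most `ε`. -/
def IsCompactAdjointable (K : Std A →L[Aᵐᵒᵖ] Std A) : Prop :=
  IsAdjointable K ∧ ∀ ε : ℝ, 0 < ε → ∃ (n : ℕ) (x y : Fin n → Std A),
    ∀ z, ‖K z - (∑ j, rankOne (x j) (y j)) z‖ ≤ ε * ‖z‖

/-- `F` is upper semi-`A`-Fredholm: `F` is adjointable and there are decompositions into direct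
sums (not necessarily orthogonal) of closed submodules `H_A = M₁ ⊕ N₁` and `H_A = M₂ ⊕ N₂` such
that `F` is block diagonal, restricts to an isomorphism (linear homeomorphism) of `M₁` onto `M₂`,
and maps `N₁` into `N₂`, where `N₁` is finitely generated. -/
def IsUpperSemiFredholm (F : Std A →L[Aᵐᵒᵖ] Std A) : Prop :=
  IsAdjointable F ∧ ∃ M₁ N₁ M₂ N₂ : Submodule Aᵐᵒᵖ (Std A),
    IsClosed (M₁ : Set (Std A)) ∧ IsClosed (N₁ : Set (Std A)) ∧
    IsClosed (M₂ : Set (Std A)) ∧ IsClosed (N₂ : Set (Std A)) ∧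
    IsCompl M₁ N₁ ∧ IsCompl M₂ N₂ ∧
    (∃ e : M₁ ≃L[Aᵐᵒᵖ] M₂, ∀ x : M₁, (e x : Std A) = F x) ∧
    (∀ x ∈ N₁, F x ∈ N₂) ∧ N₁.FG

end Operators

end HilbertModule

end

/-!
Everything passes through the condition `BoundedBelowOnTail F`: for some `n`, the operator `F` is
bounded below on the vectors of `H_A` whose first `n` coordinates vanish. The theorem says that both
sides are equivalent to this condition.

*Fredholm operators.* If `F` is upper semi-Fredholm, then it is bounded below on a tail, because the
tails of the vectors in the finitely generated summand `N₁` are uniformly small (open mapping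
theorem, `exists_tail_le_of_fg`). Conversely, if `F` is bounded below on a tail, then by Paschke's
trick (`smul_ip_self_le`) the norm estimate is an inequality of `A`-valued inner products, so that
`F* F`, compressed to the tail, is coercive and hence invertible (`exists_inverse_of_coercive`).
This gives a left inverse `G` of `F` on the tail, and the idempotents `G F` and `F G` give the two
decompositions of `H_A`.

*Kernels of compact perturbations.* Compact operators are small on tails, so the condition passes
from `F` to `F - K`. The kernel of an operator that is bounded below on a tail is the image of the
module of relations between finitely many vectors of `H_A`, that is, of the right annihilator of a
Gram matrix `Γ`. This is the only place where `A` has to be a W⋆-algebra: the weak-⋆ limit along a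
free ultrafilter is a contractive projection of `ℓ^∞(A)` onto `A`, hence `A`-linear by Tomiyama's
theorem (`map_mul_left`), so the entrywise limit `e` of the resolvents `(1 + k Γ* Γ)⁻¹` satisfies
`Γ e = 0` and `e w = w` whenever `Γ w = 0`. The columns of `e` generate the annihilator
(`exists_matrix_annihilator`, `fg_of_relations`). Tomiyama's theorem is proved without the bidual
and without projections: annihilation by positive elements is preserved by a norm computation
(`mul_map_eq_zero`), and a partition of unity on the spectrum does the rest.

*Operators that are not bounded below on any tail.* Then there are vectors `x k` of norm at most `1`
with disjoint finite supports and `‖F (x k)‖ ≤ 2⁻ᵏ`, and `a k ≠ 0` with `⟨x k, x k⟩ a k = a k`. The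
compact operator `K = ∑ θ_{F (x k), x k}` agrees with `F` on every `x k a k ≠ 0`. Hence the kernel
of `F - K` contains nonzero vectors supported arbitrarily far out and is not finitely generated,
again by `exists_tail_le_of_fg`.
-/

noncomputable section

namespace HilbertModule

/-! ### Partitions of unity and contractive projections -/

section Tent

/-- The tent function centred at `t`: it is `1` at `t`, vanishes outside `(t - 1, t + 1)` and is
affine in between, written as a second difference of the functions `min u`. -/
def tent (t u : ℝ) : ℝ := 2 * min u t - min u (t - 1) - min u (t + 1)

theorem continuous_tent (t : ℝ) : Continuous (tent t) := by
  unfold tent; fun_prop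

theorem tent_nonneg (t u : ℝ) : 0 ≤ tent t u := by
  unfold tent
  rcases min_cases u t with h | h <;> rcases min_cases u (t - 1) with h' | h' <;>
    rcases min_cases u (t + 1) with h'' | h'' <;> linarith

theorem tent_eq_zero {t u : ℝ} (h : 1 ≤ |u - t|) : tent t u = 0 := by
  unfold tent
  rcases le_abs.1 h with h | h
  · rw [min_eq_right (by linarith), min_eq_right (by linarith), min_eq_right (by linarith)]; ring
  · rw [min_eq_left (by linarith), min_eq_left (by linarith), min_eq_left (by linarith)]; ring

theorem tent_mul_tent {s t : ℝ} (h : 2 ≤ |s - t|) (u : ℝ) : tent s u * tent t u = 0 := by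
  by_cases hs : 1 ≤ |u - s|
  · rw [tent_eq_zero hs, zero_mul]
  · rw [tent_eq_zero (t := t), mul_zero]
    have := abs_sub_le s u t
    rw [abs_sub_comm s u] at this
    linarith

theorem sum_range_tent (n : ℕ) (u : ℝ) : ∑ i ∈ Finset.range n, tent i u =
    min u 0 - min u (-1) - (min u n - min u (n - 1)) := by
  induction n with
  | zero => simp
  | succ n ih =>
    rw [Finset.sum_range_succ, ih, tent]
    push_cast
    rw [add_sub_cancel_right]
    ring

theorem sum_range_mul_tent (n : ℕ) (u : ℝ) : ∑ i ∈ Finset.range n, (i : ℝ) * tent i u =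
    min u (n - 1) - min u 0 - (n - 1) * (min u n - min u (n - 1)) := by
  induction n with
  | zero => simp
  | succ n ih =>
    rw [Finset.sum_range_succ, ih, tent]
    push_cast
    rw [add_sub_cancel_right]
    ring

theorem sum_tent_le_one (s : Finset ℕ) (u : ℝ) : ∑ i ∈ s, tent i u ≤ 1 := by
  obtain ⟨n, hn⟩ := s.exists_nat_subset_range
  refine (Finset.sum_le_sum_of_subset_of_nonneg hn fun i _ _ => tent_nonneg _ _).trans ?_
  rw [sum_range_tent]
  have h1 : min u ((n : ℝ) - 1) ≤ min u n := min_le_min_left _ (by linarith)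
  rcases min_cases u 0 with h | h <;> rcases min_cases u (-1) with h' | h' <;> linarith

end Tent

/-- A double sum of a tridiagonal array, weighted by the distance to the diagonal. -/
theorem sum_sub_smul_tridiagonal {M : Type*} [AddCommGroup M] [Module ℝ M] (W : ℕ → ℕ → M)
    (hW : ∀ i j : ℕ, 2 ≤ |(i : ℝ) - j| → W i j = 0) (n : ℕ) :
    ∑ i ∈ Finset.range (n + 1), ∑ j ∈ Finset.range (n + 1), ((i : ℝ) - j) • W i j =
      ∑ i ∈ Finset.range n, W (i + 1) i - ∑ i ∈ Finset.range n, W i (i + 1) := by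
  induction n with
  | zero => simp
  | succ n ih =>
    have far : ∀ i ∈ Finset.range n, 2 ≤ |((n + 1 : ℕ) : ℝ) - i| := fun i hi => by
      have : ((i + 1 : ℕ) : ℝ) ≤ n := by exact_mod_cast Finset.mem_range.1 hi
      push_cast at this ⊢
      exact (by linarith : (2 : ℝ) ≤ n + 1 - i).trans (le_abs_self _)
    have h1 : ∑ i ∈ Finset.range (n + 1), (((i : ℕ) : ℝ) - (n + 1 : ℕ)) • W i (n + 1) =
        - W n (n + 1) := by
      rw [Finset.sum_range_succ, Finset.sum_eq_zero fun i hi => ?_]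
      · simp
      · rw [hW _ _ (by rw [abs_sub_comm]; exact far i hi), smul_zero]
    have h2 : ∑ j ∈ Finset.range (n + 1), (((n + 1 : ℕ) : ℝ) - (j : ℕ)) • W (n + 1) j =
        W (n + 1) n := by
      rw [Finset.sum_range_succ, Finset.sum_eq_zero fun i hi => ?_]
      · simp
      · rw [hW _ _ (far i hi), smul_zero]
    rw [Finset.sum_range_succ, Finset.sum_congr rfl fun i _ => Finset.sum_range_succ _ _,
      Finset.sum_add_distrib, ih, h1, Finset.sum_range_succ, h2, Finset.sum_range_succ _ n,
      Finset.sum_range_succ _ n]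
    simp only [sub_self, zero_smul, add_zero]
    abel

section Expectation

variable {A B : Type*} [CStarAlgebra A] [NonUnitalCStarAlgebra B]

/-- A contractive projection preserves annihilation by a positive contraction `f`. With `w = E y`,
the norms of `y + c f w` and of its image `w + c f w` are compared as `c → ∞`. -/
theorem mul_map_eq_zero [PartialOrder A] [StarOrderedRing A] {φ : A →⋆ₙₐ[ℂ] B} {E : B →ₗ[ℂ] A}
    (hE : ∀ b, ‖E b‖ ≤ ‖b‖) (hEφ : ∀ a, E (φ a) = a) {f : A} (hf0 : 0 ≤ f) (hf1 : f ≤ 1) {y : B}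
    (hy : φ f * y = 0) : f * E y = 0 := by
  set w := E y with hw
  have hfs : star f = f := (IsSelfAdjoint.of_nonneg hf0).star_eq
  have hff : f * f ≤ f := by
    have := CStarAlgebra.pow_antitone hf0 hf1 (show 1 ≤ 2 by norm_num)
    simpa [pow_two] using this
  -- the inequality that bounds `‖w* f² w‖` by `O(1 / c)`
  have key : ∀ c : ℝ, 0 ≤ c →
      (c ^ 2 + 2 * c) * ‖star (f * w) * (f * w)‖ ≤
        ‖y‖ ^ 2 + c ^ 2 * ‖star (f * w) * (f * w)‖ := by
    intro c hc
    have h1 : ‖y + (c : ℂ) • φ (f * w)‖ ^ 2 ≤ ‖y‖ ^ 2 + c ^ 2 * ‖star (f * w) * (f * w)‖ := by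
      have e1 : star y * φ (f * w) = 0 := by
        have : star (φ f * y) = 0 := by rw [hy, star_zero]
        rw [star_mul, ← map_star, hfs] at this
        rw [map_mul, ← mul_assoc, this, zero_mul]
      have e2 : star (φ (f * w)) * y = 0 := by
        have := congrArg star e1
        simpa using this
      have e3 : star (y + (c : ℂ) • φ (f * w)) * (y + (c : ℂ) • φ (f * w)) =
          star y * y + ((c : ℂ) * c) • φ (star (f * w) * (f * w)) := by
        simp only [star_add, star_smul, add_mul, mul_add, smul_mul_assoc, mul_smul_comm, e1, e2,
          Complex.star_def, Complex.conj_ofReal, smul_zero, add_zero, zero_add, smul_smul]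
        rw [map_mul φ (star _), map_star]
      rw [pow_two, ← CStarRing.norm_star_mul_self, e3]
      refine (norm_add_le _ _).trans ?_
      rw [CStarRing.norm_star_mul_self, norm_smul, ← pow_two]
      gcongr
      · simp [pow_two]
      · exact NonUnitalStarAlgHom.norm_apply_le φ _
    have h2 : ‖w + (c : ℂ) • (f * w)‖ ≤ ‖y + (c : ℂ) • φ (f * w)‖ := by
      have := hE (y + (c : ℂ) • φ (f * w))
      rwa [map_add, map_smul, hEφ] at this
    have h3 : (c ^ 2 + 2 * c) * ‖star (f * w) * (f * w)‖ ≤ ‖w + (c : ℂ) • (f * w)‖ ^ 2 := by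
      rw [pow_two ‖_‖, ← CStarRing.norm_star_mul_self,
        ← Real.norm_of_nonneg (by positivity : (0 : ℝ) ≤ c ^ 2 + 2 * c), ← norm_smul]
      have e4 : star (w + (c : ℂ) • (f * w)) * (w + (c : ℂ) • (f * w)) =
          star w * w + ((2 * c) • (star w * f * w) + (c ^ 2) • (star (f * w) * (f * w))) := by
        simp only [star_add, star_smul, add_mul, mul_add, smul_mul_assoc, mul_smul_comm,
          star_mul, hfs, Complex.coe_smul, ← mul_assoc, star_trivial]
        module
      rw [e4]
      refine CStarAlgebra.norm_le_norm_of_nonneg_of_le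
        (smul_nonneg (by positivity) (star_mul_self_nonneg _)) ?_
      have e5 : star (f * w) * (f * w) ≤ star w * f * w := by
        have := star_left_conjugate_le_conjugate hff w
        simpa only [star_mul, hfs, mul_assoc] using this
      rw [add_smul, add_comm]
      refine le_add_of_nonneg_of_le (star_mul_self_nonneg _) ?_
      gcongr
    exact h3.trans ((pow_le_pow_left₀ (norm_nonneg _) h2 2).trans h1)
  have h0 : ‖star (f * w) * (f * w)‖ = 0 := by
    by_contra hne
    set t := ‖star (f * w) * (f * w)‖
    have ht : 0 < t := lt_of_le_of_ne (norm_nonneg _) (Ne.symm hne)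
    have := key ((‖y‖ ^ 2 + 1) / t) (by positivity)
    have h' : (‖y‖ ^ 2 + 1) / t * t = ‖y‖ ^ 2 + 1 := div_mul_cancel₀ _ hne
    nlinarith [sq_nonneg ‖y‖]
  exact (CStarRing.star_mul_self_eq_zero_iff _).1 (norm_eq_zero.1 h0)

/-- **Tomiyama's theorem** for positive contractions: the unit interval is cut into `n` pieces by a
partition of unity of tents `q i`, evaluated at `a`; by `mul_map_eq_zero` only neighbouring tents
interact in `a * E x - E (φ a * x) = ∑ (i - j) / n • (q i * E (φ (q j) * x))`. -/
theorem map_mul_left_of_le_one [PartialOrder A] [StarOrderedRing A] {φ : A →⋆ₙₐ[ℂ] B}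
    {E : B →ₗ[ℂ] A} (hE : ∀ b, ‖E b‖ ≤ ‖b‖) (hEφ : ∀ a, E (φ a) = a)
    (hφ1 : ∀ b, φ 1 * b = b) {a : A} (ha0 : 0 ≤ a) (ha1 : a ≤ 1) (x : B) :
    E (φ a * x) = a * E x := by
  have has : IsSelfAdjoint a := .of_nonneg ha0
  have hspec : ∀ s ∈ spectrum ℝ a, 0 ≤ s ∧ s ≤ 1 := fun s hs =>
    ⟨spectrum_nonneg_of_nonneg ha0 hs, (CFC.le_one_iff a).1 ha1 s hs⟩
  have main : ∀ n : ℕ, n ≠ 0 → (n : ℝ) * ‖a * E x - E (φ a * x)‖ ≤ 6 * ‖x‖ := by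
    intro n hn
    have hn' : (0 : ℝ) < n := by positivity
    let q : ℕ → A := fun i => cfc (fun s : ℝ => tent i (n * s)) a
    have hqc : ∀ i : ℕ, Continuous fun s : ℝ => tent i (n * s) := fun i =>
      (continuous_tent i).comp (continuous_const.mul continuous_id)
    have q0 : ∀ i, 0 ≤ q i := fun i => cfc_nonneg fun s _ => tent_nonneg _ _
    have q1 : ∀ i, q i ≤ 1 := fun i => by
      refine cfc_le_one _ _ fun s _ => ?_
      simpa using sum_tent_le_one {i} (n * s)
    have qq : ∀ i j : ℕ, 2 ≤ |(i : ℝ) - j| → q i * q j = 0 := fun i j hij => by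
      rw [← cfc_mul _ _ a (hqc i).continuousOn (hqc j).continuousOn]
      simp only [tent_mul_tent hij, cfc_const_zero]
    have qsum : ∀ s : Finset ℕ, ‖∑ i ∈ s, q i‖ ≤ 1 := fun s => by
      rw [← cfc_sum _ a s fun i _ => (hqc i).continuousOn]
      refine norm_cfc_le zero_le_one fun t _ => ?_
      rw [Finset.sum_apply, Real.norm_of_nonneg (Finset.sum_nonneg fun i _ => tent_nonneg _ _)]
      exact sum_tent_le_one _ _
    have sum1 : ∑ i ∈ Finset.range (n + 1), q i = 1 := by
      rw [← cfc_sum _ a _ fun i _ => (hqc i).continuousOn, ← cfc_one (R := ℝ) a]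
      refine cfc_congr fun s hs => ?_
      obtain ⟨h0, h1⟩ := hspec s hs
      have h2 : n * s ≤ n := by nlinarith
      have h3 : 0 ≤ n * s := by positivity
      rw [Finset.sum_apply, sum_range_tent]
      push_cast
      rw [add_sub_cancel_right, min_eq_right h3, min_eq_right (by linarith), min_eq_left h2,
        min_eq_left (by linarith)]
      simp
    have suma : ∑ i ∈ Finset.range (n + 1), (i : ℝ) • q i = (n : ℝ) • a := by
      have h1 : ∀ i : ℕ, (i : ℝ) • q i = cfc (fun s : ℝ => (i : ℝ) * tent i (n * s)) a :=
        fun i => (cfc_smul (i : ℝ) _ a (hqc i).continuousOn).symm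
      have h2 : (n : ℝ) • a = cfc (fun s : ℝ => (n : ℝ) * s) a :=
        (cfc_const_mul_id (n : ℝ) a).symm
      rw [Finset.sum_congr rfl fun i _ => h1 i, h2,
        ← cfc_sum (fun (i : ℕ) (s : ℝ) => (i : ℝ) * tent i (n * s)) a _ fun i _ =>
          (continuous_const.mul (hqc i)).continuousOn]
      refine cfc_congr fun s hs => ?_
      obtain ⟨h0, h1⟩ := hspec s hs
      have h2 : n * s ≤ n := by nlinarith
      have h3 : 0 ≤ n * s := by positivity
      rw [Finset.sum_apply, sum_range_mul_tent]
      push_cast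
      rw [add_sub_cancel_right, min_eq_right h3, min_eq_left h2, min_eq_left (by linarith)]
      ring
    let W : ℕ → ℕ → A := fun i j => q i * E (φ (q j) * x)
    have hW : ∀ i j : ℕ, 2 ≤ |(i : ℝ) - j| → W i j = 0 := fun i j hij =>
      mul_map_eq_zero hE hEφ (q0 i) (q1 i) (by rw [← mul_assoc, ← map_mul, qq i j hij]; simp)
    have e1 : (n : ℝ) • (a * E x) =
        ∑ i ∈ Finset.range (n + 1), ∑ j ∈ Finset.range (n + 1), (i : ℝ) • W i j := by
      have : E x = ∑ j ∈ Finset.range (n + 1), E (φ (q j) * x) := by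
        rw [← map_sum, ← Finset.sum_mul, ← map_sum, sum1, hφ1]
      rw [← smul_mul_assoc, ← suma, this, Finset.sum_mul_sum]
      simp only [W, smul_mul_assoc]
    have e2 : (n : ℝ) • E (φ a * x) =
        ∑ i ∈ Finset.range (n + 1), ∑ j ∈ Finset.range (n + 1), (j : ℝ) • W i j := by
      have : (n : ℝ) • E (φ a * x) =
          ∑ j ∈ Finset.range (n + 1), (j : ℝ) • E (φ (q j) * x) := by
        simp only [← Complex.coe_smul] at suma ⊢
        simp only [← map_smul, ← smul_mul_assoc, ← map_sum, ← Finset.sum_mul, suma]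
      rw [this, ← one_mul (∑ j ∈ Finset.range (n + 1), (j : ℝ) • E (φ (q j) * x)), ← sum1,
        Finset.sum_mul_sum]
      simp only [W, mul_smul_comm]
    have e3 : (n : ℝ) • (a * E x - E (φ a * x)) =
        ∑ i ∈ Finset.range n, W (i + 1) i - ∑ i ∈ Finset.range n, W i (i + 1) := by
      rw [← sum_sub_smul_tridiagonal W hW n, smul_sub, e1, e2, ← Finset.sum_sub_distrib]
      simp only [← Finset.sum_sub_distrib, sub_smul]
    -- within a residue class mod 3 the interacting pairs decouple, so that the sum over the class
    -- is a single product
    have split : ∀ g h : ℕ → A, (∀ s : Finset ℕ, ‖∑ i ∈ s, g i‖ ≤ 1) →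
        (∀ s : Finset ℕ, ‖∑ i ∈ s, h i‖ ≤ 1) →
        (∀ i j, i % 3 = j % 3 → i ≠ j → g i * E (φ (h j) * x) = 0) →
        ‖∑ i ∈ Finset.range n, g i * E (φ (h i) * x)‖ ≤ 3 * ‖x‖ := by
      intro g h hg hh hgh
      rw [← Finset.sum_fiberwise_of_maps_to (g := fun i => i % 3) (t := Finset.range 3)
        fun i _ => Finset.mem_range.2 (Nat.mod_lt _ (by norm_num))]
      refine (norm_sum_le_of_le (Finset.range 3) (f := fun r => ∑ i ∈ Finset.range n with i % 3 = r,
        g i * E (φ (h i) * x)) (n := fun _ => ‖x‖) fun r _ => ?_).trans (by simp)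
      set s := (Finset.range n).filter fun i => i % 3 = r with hs
      have : ∑ i ∈ s, g i * E (φ (h i) * x) =
          (∑ i ∈ s, g i) * E (φ (∑ i ∈ s, h i) * x) := by
        simp only [map_sum, Finset.sum_mul, Finset.mul_sum]
        rw [Finset.sum_comm]
        refine Finset.sum_congr rfl fun i hi => ?_
        rw [Finset.sum_eq_single_of_mem i hi]
        intro j hj hji
        refine hgh _ _ ?_ hji.symm
        rw [hs, Finset.mem_filter] at hi hj
        rw [hi.2, hj.2]
      rw [this]
      calc _ ≤ ‖∑ i ∈ s, g i‖ * ‖E (φ (∑ i ∈ s, h i) * x)‖ := norm_mul_le _ _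
        _ ≤ 1 * (1 * ‖x‖) := by
          gcongr
          · exact hg s
          · refine (hE _).trans ((norm_mul_le _ _).trans ?_)
            gcongr
            exact (NonUnitalStarAlgHom.norm_apply_le φ _).trans (hh s)
        _ = ‖x‖ := by ring
    have qsum' : ∀ s : Finset ℕ, ‖∑ i ∈ s, q (i + 1)‖ ≤ 1 := fun s => by
      have := qsum (s.map (addRightEmbedding 1))
      simpa [Finset.sum_map] using this
    have mod3 : ∀ i j : ℕ, i % 3 = j % 3 → i ≠ j →
        2 ≤ |((i + 1 : ℕ) : ℝ) - j| ∧ 2 ≤ |(i : ℝ) - (j + 1 : ℕ)| := by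
      intro i j hij hne
      have h1 : 2 ≤ |((i + 1 : ℕ) : ℤ) - j| ∧ 2 ≤ |(i : ℤ) - (j + 1 : ℕ)| := by
        rw [le_abs, le_abs]; omega
      exact_mod_cast h1
    have b1 := split (fun i => q (i + 1)) q qsum' qsum fun i j hij hne =>
      hW _ _ (mod3 i j hij hne).1
    have b2 := split q (fun i => q (i + 1)) qsum qsum' fun i j hij hne =>
      hW _ _ (mod3 i j hij hne).2
    calc (n : ℝ) * ‖a * E x - E (φ a * x)‖ = ‖(n : ℝ) • (a * E x - E (φ a * x))‖ := by
          rw [norm_smul, Real.norm_of_nonneg hn'.le]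
      _ ≤ 3 * ‖x‖ + 3 * ‖x‖ := by rw [e3]; exact norm_sub_le_of_le b1 b2
      _ = 6 * ‖x‖ := by ring
  by_contra hne
  have hpos : 0 < ‖a * E x - E (φ a * x)‖ := norm_pos_iff.2 (sub_ne_zero.2 (Ne.symm hne))
  obtain ⟨n, hn⟩ := exists_nat_gt (6 * ‖x‖ / ‖a * E x - E (φ a * x)‖)
  have hn0 : n ≠ 0 := by
    rintro rfl
    have : 0 ≤ 6 * ‖x‖ / ‖a * E x - E (φ a * x)‖ := by positivity
    simp only [Nat.cast_zero] at hn
    linarith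
  rw [div_lt_iff₀ hpos] at hn
  linarith [main n hn0]

/-- **Tomiyama's theorem**, left module property: a contractive projection of a C⋆-algebra onto a
C⋆-subalgebra `φ(A)` (whose unit acts as a left unit) is `A`-linear. -/
theorem map_mul_left {φ : A →⋆ₙₐ[ℂ] B} {E : B →ₗ[ℂ] A} (hE : ∀ b, ‖E b‖ ≤ ‖b‖)
    (hEφ : ∀ a, E (φ a) = a) (hφ1 : ∀ b, φ 1 * b = b) (a : A) (x : B) :
    E (φ a * x) = a * E x := by
  let _ := CStarAlgebra.spectralOrder A
  have _ := CStarAlgebra.spectralOrderedRing A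
  have ha : a ∈ Submodule.span ℂ {a : A | 0 ≤ a} := by
    rw [CStarAlgebra.span_nonneg]; trivial
  induction ha using Submodule.span_induction with
  | zero => simp
  | add a b _ _ iha ihb => simp only [map_add, add_mul, iha, ihb]
  | smul c a _ iha => simp only [map_smul, smul_mul_assoc, iha]
  | mem a ha =>
    rcases eq_or_ne a 0 with rfl | hne
    · simp
    have hn : 0 < ‖a‖ := norm_pos_iff.2 hne
    have h1 : (‖a‖⁻¹ • a) ≤ 1 := by
      rw [← CStarAlgebra.norm_le_one_iff_of_nonneg _ (smul_nonneg (by positivity) ha), norm_smul,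
        Real.norm_of_nonneg (by positivity), inv_mul_cancel₀ hn.ne']
    have h2 := map_mul_left_of_le_one hE hEφ hφ1 (smul_nonneg (by positivity) ha) h1 x
    rw [← Complex.coe_smul, map_smul, smul_mul_assoc, map_smul, smul_mul_assoc] at h2
    exact smul_right_injective _ (by simpa using hne) h2

/-- **Tomiyama's theorem**, right module property, from the left one applied to
`x ↦ (E (x*))*`. -/
theorem map_mul_right {φ : A →⋆ₙₐ[ℂ] B} {E : B →ₗ[ℂ] A} (hE : ∀ b, ‖E b‖ ≤ ‖b‖)
    (hEφ : ∀ a, E (φ a) = a) (hφ1 : ∀ b, φ 1 * b = b) (a : A) (x : B) :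
    E (x * φ a) = E x * a := by
  let E' : B →ₗ[ℂ] A :=
    { toFun := fun b => star (E (star b))
      map_add' := fun b c => by simp
      map_smul' := fun c b => by simp }
  have h := map_mul_left (φ := φ) (E := E')
    (fun b => by simpa [E'] using hE (star b)) (fun a => by simp [E', ← map_star, hEφ]) hφ1
    (star a) (star x)
  simpa [E', map_star] using congrArg star h

end Expectation

/-! ### Weak-⋆ limits and annihilators over W⋆-algebras -/

section GeneralizedLimit

variable {A : Type*} [CStarAlgebra A]

/-- The embedding of `A` as the constant sequences in `ℓ^∞(A)`. -/
def constSeq (A : Type*) [CStarAlgebra A] : A →⋆ₙₐ[ℂ] lp (fun _ : ℕ => A) ⊤ where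
  toFun a := ⟨fun _ => a, memℓp_infty ⟨‖a‖, by rintro _ ⟨i, rfl⟩; exact le_rfl⟩⟩
  map_smul' _ _ := rfl
  map_zero' := rfl
  map_add' _ _ := rfl
  map_mul' _ _ := rfl
  map_star' _ := rfl

theorem constSeq_apply (a : A) (k : ℕ) : constSeq A a k = a := rfl

theorem constSeq_one_mul (b : lp (fun _ : ℕ => A) ⊤) : constSeq A 1 * b = b := by
  ext k
  simp [lp.infty_coeFn_mul, constSeq_apply]

/-- On a W⋆-algebra, the weak-⋆ limit along a free ultrafilter is a contractive projection of
`ℓ^∞(A)` onto the constant sequences that annihilates the null sequences. -/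
theorem exists_generalizedLimit (A : Type*) [CStarAlgebra A] [WStarAlgebra A] :
    ∃ E : lp (fun _ : ℕ => A) ⊤ →ₗ[ℂ] A, (∀ b, ‖E b‖ ≤ ‖b‖) ∧ (∀ a, E (constSeq A a) = a) ∧
      ∀ b : lp (fun _ : ℕ => A) ⊤, Filter.Tendsto (fun k => b k) Filter.atTop (nhds 0) →
        E b = 0 := by
  obtain ⟨X, _, _, _, ⟨Φ⟩⟩ := WStarAlgebra.exists_predual (M := A)
  let U : Ultrafilter ℕ := Filter.hyperfilter ℕ
  have hbd : ∀ (b : lp (fun _ : ℕ => A) ⊤) (ξ : X) (k : ℕ),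
      ‖Φ.symm (b k) ξ‖ ≤ ‖b‖ * ‖ξ‖ := fun b ξ k => by
    refine (ContinuousLinearMap.le_opNorm _ _).trans ?_
    gcongr
    rw [LinearIsometryEquiv.norm_map]
    exact lp.norm_apply_le_norm ENNReal.top_ne_zero b k
  have hlim : ∀ (b : lp (fun _ : ℕ => A) ⊤) (ξ : X),
      ∃ z : ℂ, ‖z‖ ≤ ‖b‖ * ‖ξ‖ ∧
        Filter.Tendsto (fun k => Φ.symm (b k) ξ) U (nhds z) := fun b ξ => by
    obtain ⟨z, hz, h⟩ := (isCompact_closedBall (0 : ℂ) (‖b‖ * ‖ξ‖)).ultrafilter_le_nhds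
      (U.map fun k => Φ.symm (b k) ξ) (by
        rw [Filter.le_principal_iff]
        refine Filter.Eventually.of_forall (p := fun k : ℕ => Φ.symm (b k) ξ ∈ _) fun k => ?_
        simpa using hbd b ξ k)
    exact ⟨z, by simpa using hz, h⟩
  choose g hg hgt using hlim
  have hw : ∀ b : lp (fun _ : ℕ => A) ⊤, ∃ w : A, ‖w‖ ≤ ‖b‖ ∧
      ∀ ξ, Filter.Tendsto (fun k => Φ.symm (b k) ξ) U (nhds (Φ.symm w ξ)) := fun b => by
    let l : X →ₗ[ℂ] ℂ :=
      { toFun := g b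
        map_add' := fun ξ η => tendsto_nhds_unique (hgt b (ξ + η)) (by
          simpa only [map_add] using (hgt b ξ).add (hgt b η))
        map_smul' := fun c ξ => tendsto_nhds_unique (hgt b (c • ξ)) (by
          simpa only [map_smul, RingHom.id_apply] using (hgt b ξ).const_smul c) }
    refine ⟨Φ (l.mkContinuous ‖b‖ (hg b)), ?_, fun ξ => ?_⟩
    · rw [LinearIsometryEquiv.norm_map]
      exact l.mkContinuous_norm_le (norm_nonneg _) _
    · rw [LinearIsometryEquiv.symm_apply_apply]
      exact hgt b ξ
  choose w hwn hwt using hw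
  have huniq : ∀ {u v : A}, (∀ ξ, Φ.symm u ξ = Φ.symm v ξ) → u = v := fun h =>
    Φ.symm.injective (ContinuousLinearMap.ext h)
  refine ⟨{ toFun := w, map_add' := fun b c => ?_, map_smul' := fun c b => ?_ }, hwn,
    fun a => ?_, fun b hb => ?_⟩
  · refine huniq fun ξ => tendsto_nhds_unique (hwt (b + c) ξ) ?_
    simpa using (hwt b ξ).add (hwt c ξ)
  · refine huniq fun ξ => tendsto_nhds_unique (hwt (c • b) ξ) ?_
    have hs : ∀ u : A, Φ.symm (c • u) ξ = star c • Φ.symm u ξ := fun u => by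
      rw [map_smulₛₗ]; rfl
    simp only [RingHom.id_apply, hs, lp.coeFn_smul, Pi.smul_apply]
    exact (hwt b ξ).const_smul (star c)
  · exact huniq fun ξ => tendsto_nhds_unique (hwt _ ξ) tendsto_const_nhds
  · refine huniq fun ξ => tendsto_nhds_unique (hwt b ξ) ?_
    have h1 : Continuous fun a => Φ.symm a ξ :=
      (ContinuousLinearMap.apply ℂ ℂ ξ).continuous.comp Φ.symm.continuous
    have h2 := (h1.tendsto 0).comp hb
    exact h2.mono_left (Nat.hyperfilter_le_atTop)

end GeneralizedLimit

section Annihilator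

/-- The resolvents `(1 + k R)⁻¹` of `R = c* c`. -/
theorem exists_resolvents {D : Type*} [CStarAlgebra D] (c : D) :
    ∃ r : ℕ → D, (∀ k, ‖r k‖ ≤ 1) ∧ (∀ k, r k * (1 + k • (star c * c)) = 1) ∧
      ∀ k : ℕ, k ≠ 0 → ‖star c * c * r k‖ ≤ 1 / k := by
  let _ := CStarAlgebra.spectralOrder D
  have _ := CStarAlgebra.spectralOrderedRing D
  set R := star c * c with hR
  have hR0 : 0 ≤ R := star_mul_self_nonneg c
  have hspec : ∀ s ∈ spectrum ℝ R, 0 ≤ s := fun s hs => spectrum_nonneg_of_nonneg hR0 hs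
  have hRs : IsSelfAdjoint R := .of_nonneg hR0
  have hpos : ∀ (k : ℕ), ∀ s ∈ spectrum ℝ R, 0 < 1 + (k : ℝ) * s := fun k s hs => by
    have := hspec s hs
    positivity
  have hcont : ∀ k : ℕ, ContinuousOn (fun s : ℝ => (1 + (k : ℝ) * s)⁻¹) (spectrum ℝ R) :=
    fun k => ContinuousOn.inv₀ (by fun_prop) fun s hs => (hpos k s hs).ne'
  refine ⟨fun k => cfc (fun s : ℝ => (1 + (k : ℝ) * s)⁻¹) R, fun k => ?_, fun k => ?_,
    fun k hk => ?_⟩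
  · refine norm_cfc_le zero_le_one fun s hs => ?_
    have := hspec s hs
    rw [norm_inv, Real.norm_of_nonneg (hpos k s hs).le]
    exact inv_le_one_of_one_le₀ (le_add_of_nonneg_right (by positivity))
  · have : 1 + k • R = cfc (fun s : ℝ => 1 + (k : ℝ) * s) R := by
      rw [cfc_const_add (1 : ℝ) _ R, cfc_const_mul_id (k : ℝ) R, map_one, Nat.cast_smul_eq_nsmul]
    rw [this, ← cfc_mul _ _ R (hcont k), ← cfc_one (R := ℝ) R]
    exact cfc_congr fun s hs => inv_mul_cancel₀ (hpos k s hs).ne'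
  · have : R * cfc (fun s : ℝ => (1 + (k : ℝ) * s)⁻¹) R =
        cfc (fun s : ℝ => s * (1 + (k : ℝ) * s)⁻¹) R := by
      rw [cfc_mul _ _ R (by fun_prop) (hcont k), cfc_id' ℝ R]
    rw [this]
    refine norm_cfc_le (by positivity) fun s hs => ?_
    have h0 := hspec s hs
    rw [Real.norm_of_nonneg (mul_nonneg h0 (inv_nonneg.2 (hpos k s hs).le)), ← div_eq_mul_inv,
      div_le_div_iff₀ (hpos k s hs) (by positivity)]
    linarith

variable {A : Type*} [CStarAlgebra A] [WStarAlgebra A]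

/-- Matrices over a W⋆-algebra have right annihilators generated by one matrix: `e` is the
entrywise generalized limit of the resolvents `(1 + k Γ* Γ)⁻¹`. -/
theorem exists_matrix_annihilator [PartialOrder A] [StarOrderedRing A] {m : ℕ}
    (Γ : CStarMatrix (Fin m) (Fin m) A) :
    ∃ e : CStarMatrix (Fin m) (Fin m) A, Γ * e = 0 ∧
      ∀ M : CStarMatrix (Fin m) (Fin m) A, Γ * M = 0 → e * M = M := by
  obtain ⟨E, hE, hEc, hE0⟩ := exists_generalizedLimit A
  set R := star Γ * Γ with hR
  obtain ⟨r, hr1, hr2, hr3⟩ := exists_resolvents Γ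
  let b : Fin m → Fin m → lp (fun _ : ℕ => A) ⊤ := fun i j =>
    ⟨fun k => r k i j, memℓp_infty ⟨1, by
      rintro _ ⟨k, rfl⟩
      exact CStarMatrix.norm_entry_le_norm.trans (hr1 k)⟩⟩
  have hb : ∀ i j k, b i j k = r k i j := fun _ _ _ => rfl
  let e : CStarMatrix (Fin m) (Fin m) A := CStarMatrix.ofMatrix (.of fun i j => E (b i j))
  have he : ∀ i j, e i j = E (b i j) := fun _ _ => rfl
  refine ⟨e, ?_, fun M hM => ?_⟩
  · have h1 : R * e = 0 := by
      ext i j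
      have h2 : (R * e) i j = E (∑ l, constSeq A (R i l) * b l j) := by
        rw [CStarMatrix.mul_apply, map_sum]
        exact Finset.sum_congr rfl fun l _ =>
          (map_mul_left hE hEc constSeq_one_mul (R i l) (b l j)).symm
      rw [h2, CStarMatrix.zero_apply]
      refine hE0 _ ?_
      have h3 : ∀ k, (∑ l, constSeq A (R i l) * b l j : lp (fun _ : ℕ => A) ⊤) k =
          (R * r k) i j := fun k => by
        rw [CStarMatrix.mul_apply, lp.coeFn_sum, Finset.sum_apply]
        rfl
      simp only [h3]
      refine squeeze_zero_norm' ?_ tendsto_one_div_atTop_nhds_zero_nat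
      filter_upwards [Filter.eventually_ne_atTop 0] with k hk
      exact CStarMatrix.norm_entry_le_norm.trans (hr3 k hk)
    refine (CStarRing.star_mul_self_eq_zero_iff _).1 ?_
    rw [star_mul, mul_assoc, ← mul_assoc (star Γ), ← hR, h1, mul_zero]
  · have hRM : R * M = 0 := by rw [hR, mul_assoc, hM, mul_zero]
    have hrM : ∀ k, r k * M = M := fun k => by
      calc r k * M = r k * ((1 + k • R) * M) := by
            rw [add_mul, one_mul, smul_mul_assoc, hRM, smul_zero, add_zero]
        _ = M := by rw [← mul_assoc, hr2, one_mul]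
    ext i j
    have h2 : (e * M) i j = E (∑ l, b i l * constSeq A (M l j)) := by
      rw [CStarMatrix.mul_apply, map_sum]
      exact Finset.sum_congr rfl fun l _ =>
        (map_mul_right hE hEc constSeq_one_mul (M l j) (b i l)).symm
    have h3 : (∑ l, b i l * constSeq A (M l j) : lp (fun _ : ℕ => A) ⊤) = constSeq A (M i j) := by
      ext k
      rw [constSeq_apply]
      nth_rw 2 [← hrM k]
      rw [CStarMatrix.mul_apply, lp.coeFn_sum, Finset.sum_apply]
      rfl
    rw [h2, h3, hEc]

/-- The relations between finitely many elements of `H_A`, for a W⋆-algebra `A`, form a finitely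
generated module: they are the right annihilator of the Gram matrix. -/
theorem fg_of_relations {m : ℕ} (v : Fin m → Std A) (L : Submodule Aᵐᵒᵖ (Fin m → A))
    (hL : ∀ a, a ∈ L ↔ ∑ i, op (a i) • v i = 0) : L.FG := by
  let _ := CStarAlgebra.spectralOrder A
  have _ := CStarAlgebra.spectralOrderedRing A
  let Γ : CStarMatrix (Fin m) (Fin m) A := CStarMatrix.ofMatrix (.of fun i j => Std.ip (v i) (v j))
  have ip_sum : ∀ (x : Std A) (a : Fin m → A),
      Std.ip x (∑ i, op (a i) • v i) = ∑ i, Std.ip x (v i) * a i := fun x a => by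
    let f : Std A →+ A :=
      { toFun := Std.ip x, map_zero' := by simp [Std.ip], map_add' := Std.ip_add_right x }
    change f _ = _
    rw [map_sum]
    exact Finset.sum_congr rfl fun i _ => Std.ip_op_smul_right _ _ _
  have hΓ : ∀ a : Fin m → A, ∑ i, op (a i) • v i = 0 ↔ ∀ i, ∑ j, Γ i j * a j = 0 := fun a => by
    constructor
    · intro h i
      have := ip_sum (v i) a
      rw [h] at this
      rw [← show _ = ∑ j, Γ i j * a j from this]
      simp [Std.ip]
    · intro h
      rw [← Std.ip_self_eq_zero, ip_sum]
      refine Finset.sum_eq_zero fun i _ => ?_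
      rw [← Std.star_ip, ip_sum]
      rw [show ∑ j, Std.ip (v i) (v j) * a j = 0 from h i, star_zero, zero_mul]
  obtain ⟨e, he, heM⟩ := exists_matrix_annihilator Γ
  rw [Submodule.fg_iff_exists_fin_generating_family]
  refine ⟨m, fun j i => e i j, le_antisymm (Submodule.span_le.2 ?_) fun a ha => ?_⟩
  · rintro _ ⟨j, rfl⟩
    rw [SetLike.mem_coe, hL, hΓ]
    intro i
    simpa [CStarMatrix.mul_apply] using congrArg (fun M : CStarMatrix _ _ A => M i j) he
  · rw [hL, hΓ] at ha
    let M : CStarMatrix (Fin m) (Fin m) A := CStarMatrix.ofMatrix (.of fun i _ => a i)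
    have hM : Γ * M = 0 := by
      ext i j
      rw [CStarMatrix.mul_apply]
      exact ha i
    have h1 : a = ∑ j, op (a j) • fun i => e i j := by
      ext i
      have := congrArg (fun M : CStarMatrix _ _ A => M i i) (heM M hM)
      simp only [CStarMatrix.mul_apply] at this
      rw [Finset.sum_apply]
      exact this.symm
    rw [h1]
    exact Submodule.sum_mem _ fun j _ =>
      Submodule.smul_mem _ _ (Submodule.subset_span ⟨j, rfl⟩)

end Annihilator

/-! ### Completeness and coordinate projections of `H_A` -/

namespace Std

variable {A : Type*} [CStarAlgebra A]

/-- A square summable sequence as an element of `H_A`. -/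
def mk (y : ℕ → A) (h : Summable fun i => star (y i) * y i) : Std A := ⟨y, h⟩

@[simp] theorem mk_apply (y : ℕ → A) (h : Summable fun i => star (y i) * y i) (i : ℕ) :
    mk y h i = y i := rfl

theorem ip_smul_left (x y : Std A) (c : ℂ) : ip (c • x) y = star c • ip x y := by
  rw [← star_ip, ip_smul_right, star_smul, star_ip]

theorem ip_op_smul_left (x y : Std A) (a : Aᵐᵒᵖ) : ip (a • x) y = star (unop a) * ip x y := by
  rw [← star_ip, ip_op_smul_right, star_mul, star_ip]

theorem ip_smul_smul_self (x : Std A) (a : A) :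
    ip (op a • x) (op a • x) = star a * ip x x * a := by
  rw [ip_op_smul_right, ip_op_smul_left, unop_op]

/-- The bounded functional `⟨x, ·⟩`. -/
def ipL (x : Std A) : Std A →L[ℂ] A :=
  LinearMap.mkContinuous ⟨⟨ip x, ip_add_right x⟩, fun c y => ip_smul_right x y c⟩ ‖x‖
    (norm_ip_le x)

@[simp] theorem ipL_apply (x y : Std A) : ipL x y = ip x y := rfl

@[simp] theorem ip_zero_right (x : Std A) : ip x 0 = 0 := map_zero (ipL x)

@[simp] theorem ip_zero_left (x : Std A) : ip 0 x = 0 := by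
  rw [← star_ip, ip_zero_right, star_zero]

theorem ip_sub_right (x y z : Std A) : ip x (y - z) = ip x y - ip x z := map_sub (ipL x) y z

theorem ip_sub_left (x y z : Std A) : ip (x - y) z = ip x z - ip y z := by
  rw [← star_ip, ip_sub_right, star_sub, star_ip, star_ip]

theorem sub_apply (x y : Std A) (i : ℕ) : (x - y) i = x i - y i := rfl

theorem norm_sum_star_mul_self_le (x : Std A) (s : Finset ℕ) :
    ‖∑ i ∈ s, star (x i) * x i‖ ≤ ‖x‖ ^ 2 := by
  let _ := CStarAlgebra.spectralOrder A
  have _ := CStarAlgebra.spectralOrderedRing A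
  rw [norm_sq_eq]
  exact CStarAlgebra.norm_le_norm_of_nonneg_of_le
    (Finset.sum_nonneg fun i _ => star_mul_self_nonneg _)
    ((summable_ip x x).sum_le_tsum s fun i _ => star_mul_self_nonneg _)

theorem norm_apply_le (x : Std A) (i : ℕ) : ‖x i‖ ≤ ‖x‖ := by
  refine le_of_sq_le_sq ?_ (norm_nonneg _)
  rw [pow_two, ← CStarRing.norm_star_mul_self]
  simpa using norm_sum_star_mul_self_le x {i}

theorem norm_le_of_sum_le (x : Std A) {C : ℝ} (hC : 0 ≤ C)
    (h : ∀ s : Finset ℕ, ‖∑ i ∈ s, star (x i) * x i‖ ≤ C ^ 2) : ‖x‖ ≤ C := by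
  refine le_of_sq_le_sq ?_ hC
  rw [norm_sq_eq]
  exact le_of_tendsto (summable_ip x x).hasSum.norm (Filter.Eventually.of_forall h)

/-- `H_A` is complete: coordinatewise limits of Cauchy sequences are again square summable, by the
uniform control of the finite partial sums. -/
instance : CompleteSpace (Std A) := by
  let _ := CStarAlgebra.spectralOrder A
  have _ := CStarAlgebra.spectralOrderedRing A
  refine Metric.complete_of_cauchySeq_tendsto fun u hu => ?_
  have hcoord : ∀ i, ∃ a : A, Filter.Tendsto (fun k => u k i) Filter.atTop (nhds a) := fun i => by
    refine cauchySeq_tendsto_of_complete (Metric.cauchySeq_iff.2 fun ε hε => ?_)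
    obtain ⟨N, hN⟩ := Metric.cauchySeq_iff.1 hu ε hε
    refine ⟨N, fun k hk l hl => lt_of_le_of_lt ?_ (hN k hk l hl)⟩
    rw [dist_eq_norm, dist_eq_norm, ← sub_apply]
    exact norm_apply_le _ i
  choose y hy using hcoord
  have hsum : ∀ ε > 0, ∃ N, ∀ k ≥ N, ∀ s : Finset ℕ,
      ‖∑ i ∈ s, star (u k i - y i) * (u k i - y i)‖ ≤ ε ^ 2 := fun ε hε => by
    obtain ⟨N, hN⟩ := Metric.cauchySeq_iff.1 hu ε hε
    refine ⟨N, fun k hk s => ?_⟩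
    have hlim : Filter.Tendsto (fun l => ‖∑ i ∈ s, star (u k i - u l i) * (u k i - u l i)‖)
        Filter.atTop (nhds ‖∑ i ∈ s, star (u k i - y i) * (u k i - y i)‖) :=
      (tendsto_finsetSum _ fun i _ =>
        ((hy i).const_sub (u k i)).star.mul ((hy i).const_sub (u k i))).norm
    refine le_of_tendsto hlim ?_
    filter_upwards [Filter.eventually_ge_atTop N] with l hl
    refine (norm_sum_star_mul_self_le (u k - u l) s).trans ?_
    have := (hN k hk l hl).le
    rw [dist_eq_norm] at this
    gcongr
  have hmem : Summable fun i => star (y i) * y i := by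
    rw [summable_iff_vanishing_norm]
    intro ε hε
    obtain ⟨N, hN⟩ := hsum √(ε / 4) (by positivity)
    obtain ⟨s, hs⟩ := summable_iff_vanishing_norm.1 (summable_ip (u N) (u N)) (ε / 4)
      (by positivity)
    refine ⟨s, fun t ht => ?_⟩
    have h1 := hs t ht
    have h2 := hN N le_rfl t
    rw [Real.sq_sqrt (by positivity)] at h2
    have h3 : ∑ i ∈ t, star (y i) * y i ≤
        (2 : ℝ) • ∑ i ∈ t, star (u N i) * u N i +
        (2 : ℝ) • ∑ i ∈ t, star (u N i - y i) * (u N i - y i) := by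
      rw [Finset.smul_sum, Finset.smul_sum, ← Finset.sum_add_distrib]
      refine Finset.sum_le_sum fun i _ => ?_
      rw [← sub_nonneg]
      convert star_mul_self_nonneg (u N i - y i + u N i) using 1
      simp only [star_add, star_sub, two_smul]
      noncomm_ring
    calc _ ≤ _ := CStarAlgebra.norm_le_norm_of_nonneg_of_le
          (Finset.sum_nonneg fun i _ => star_mul_self_nonneg _) h3
      _ ≤ 2 * ‖∑ i ∈ t, star (u N i) * u N i‖ +
          2 * ‖∑ i ∈ t, star (u N i - y i) * (u N i - y i)‖ := by
        refine (norm_add_le _ _).trans ?_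
        rw [norm_smul, norm_smul, Real.norm_of_nonneg zero_le_two]
      _ < ε := by linarith
  refine ⟨mk y hmem, Metric.tendsto_atTop.2 fun ε hε => ?_⟩
  obtain ⟨N, hN⟩ := hsum (ε / 2) (by positivity)
  refine ⟨N, fun k hk => lt_of_le_of_lt ?_ (half_lt_self hε)⟩
  rw [dist_eq_norm]
  exact norm_le_of_sum_le _ (by positivity) (hN k hk)

end Std

variable {A : Type*} [CStarAlgebra A]

theorem summable_indicator (s : Set ℕ) (x : Std A) :
    Summable fun i => star (s.indicator x i) * s.indicator x i := by
  refine ((Std.summable_ip x x).indicator s).congr fun i => ?_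
  by_cases hi : i ∈ s <;> simp [hi]

/-- The coordinate projection `x ↦ (xᵢ)_{i ∈ s}` as a linear map. -/
def restrₗ (A : Type*) [CStarAlgebra A] (s : Set ℕ) : Std A →ₗ[Aᵐᵒᵖ] Std A where
  toFun x := Std.mk (s.indicator x) (summable_indicator s x)
  map_add' x y := by
    ext i
    by_cases hi : i ∈ s <;> simp [hi]
  map_smul' a x := by
    ext i
    by_cases hi : i ∈ s <;> simp [hi]

theorem norm_restrₗ_le (s : Set ℕ) (x : Std A) : ‖restrₗ A s x‖ ≤ ‖x‖ := by
  let _ := CStarAlgebra.spectralOrder A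
  have _ := CStarAlgebra.spectralOrderedRing A
  refine Std.norm_le_of_sum_le _ (norm_nonneg _) fun t =>
    le_trans ?_ (Std.norm_sum_star_mul_self_le x t)
  refine CStarAlgebra.norm_le_norm_of_nonneg_of_le
    (Finset.sum_nonneg fun i _ => star_mul_self_nonneg _) (Finset.sum_le_sum fun i _ => ?_)
  by_cases hi : i ∈ s <;> simp [restrₗ, hi, star_mul_self_nonneg]

/-- The coordinate projection `x ↦ (xᵢ)_{i ∈ s}` of `H_A`. -/
def restr (A : Type*) [CStarAlgebra A] (s : Set ℕ) : Std A →L[Aᵐᵒᵖ] Std A where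
  toLinearMap := restrₗ A s
  cont := AddMonoidHomClass.continuous_of_bound (restrₗ A s) 1 fun x => by
    rw [one_mul]; exact norm_restrₗ_le s x

theorem restr_apply (s : Set ℕ) (x : Std A) (i : ℕ) : restr A s x i = s.indicator x i := rfl

theorem norm_restr_le (s : Set ℕ) (x : Std A) : ‖restr A s x‖ ≤ ‖x‖ := norm_restrₗ_le s x

theorem restr_restr (s t : Set ℕ) (x : Std A) :
    restr A s (restr A t x) = restr A (s ∩ t) x := by
  ext i
  by_cases hi : i ∈ s <;> by_cases hi' : i ∈ t <;> simp [restr_apply, hi, hi']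

theorem restr_empty (x : Std A) : restr A ∅ x = 0 := by
  ext i
  simp [restr_apply]

theorem restr_add_restr_compl (s : Set ℕ) (x : Std A) : restr A s x + restr A sᶜ x = x := by
  ext i
  by_cases hi : i ∈ s <;> simp [restr_apply, hi]

theorem ip_restr_left (s : Set ℕ) (x y : Std A) :
    Std.ip (restr A s x) y = Std.ip x (restr A s y) := by
  refine tsum_congr fun i => ?_
  by_cases hi : i ∈ s <;> simp [restr_apply, hi]

theorem ip_restr_restr (s : Set ℕ) (x : Std A) :
    Std.ip (restr A s x) (restr A s x) = Std.ip x (restr A s x) := by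
  rw [ip_restr_left, restr_restr, Set.inter_self]

/-- Tails of a vector of `H_A` tend to `0`. -/
theorem tendsto_restr_Ici (x : Std A) :
    Filter.Tendsto (fun n => restr A (Set.Iio n)ᶜ x) Filter.atTop (nhds 0) := by
  have h1 : ∀ n, Std.ip x (restr A (Set.Iio n) x) = ∑ i ∈ Finset.range n, star (x i) * x i :=
    fun n => by
      rw [Std.ip, tsum_eq_sum (s := Finset.range n) fun i hi => ?_]
      · exact Finset.sum_congr rfl fun i hi => by
          rw [restr_apply, Set.indicator_of_mem (show i ∈ Set.Iio n from Finset.mem_range.1 hi)]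
      · rw [restr_apply, Set.indicator_of_notMem (by simpa using hi), mul_zero]
  have h2 : ∀ n, ‖restr A (Set.Iio n)ᶜ x‖ ^ 2 =
      ‖Std.ip x x - ∑ i ∈ Finset.range n, star (x i) * x i‖ := fun n => by
    rw [Std.norm_sq_eq, ip_restr_restr, ← h1, ← Std.ip_sub_right]
    congr 2
    exact eq_sub_of_add_eq' (restr_add_restr_compl _ x)
  have h3 : Filter.Tendsto (fun n => ‖restr A (Set.Iio n)ᶜ x‖ ^ 2) Filter.atTop (nhds 0) := by
    simp only [h2]
    have := ((Std.summable_ip x x).hasSum.tendsto_sum_nat.const_sub (Std.ip x x)).norm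
    simpa [Std.ip] using this
  rw [tendsto_zero_iff_norm_tendsto_zero]
  have := h3.sqrt
  simpa [Real.sqrt_sq] using this

/-- The `i`-th standard basis vector of `H_A`. -/
def basisVec (A : Type*) [CStarAlgebra A] (i : ℕ) : Std A :=
  Std.mk (Pi.single i 1) (summable_of_ne_finset_zero (s := {i}) fun j hj => by
    rw [Pi.single_eq_of_ne (by simpa using hj), mul_zero])

theorem sum_basisVec_apply (m : ℕ) (a : Fin m → A) (j : ℕ) :
    (∑ i : Fin m, op (a i) • basisVec A i) j = if h : j < m then a ⟨j, h⟩ else 0 := by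
  let f : Std A →+ A := ⟨⟨fun x => x j, rfl⟩, fun _ _ => rfl⟩
  change f _ = _
  rw [map_sum]
  change ∑ i : Fin m, (Pi.single (i : ℕ) (1 : A) : ℕ → A) j * a i = _
  split_ifs with h
  · rw [Finset.sum_eq_single ⟨j, h⟩ (fun i _ hi => ?_) (by simp)]
    · simp
    · rw [Pi.single_eq_of_ne (fun h' => hi (Fin.ext h'.symm)), zero_mul]
  · refine Finset.sum_eq_zero fun i _ => ?_
    rw [Pi.single_eq_of_ne (fun h' : j = (i : ℕ) => h (h'.trans_lt i.2)), zero_mul]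

/-- The projection onto the first `m` coordinates, expanded in the standard basis. -/
theorem restr_Iio_eq_sum (m : ℕ) (x : Std A) :
    restr A (Set.Iio m) x = ∑ i : Fin m, op (x i) • basisVec A i := by
  ext j
  rw [sum_basisVec_apply, restr_apply]
  by_cases h : j < m <;> simp [h]

/-- An `A`-linear bounded operator is bounded with respect to the norm. -/
theorem exists_norm_le (F : Std A →L[Aᵐᵒᵖ] Std A) : ∃ C, 0 < C ∧ ∀ x, ‖F x‖ ≤ C * ‖x‖ :=
  (F.restrictScalars ℂ).bound

/-! ### Operators bounded below on a tail -/

/-- An inequality between norms that holds for all right multiples of `x` and `z` is an inequality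
between the `A`-valued inner products (Paschke): normalise by `(⟨z, z⟩ + ε)^(-1/2)`. -/
theorem smul_ip_self_le [PartialOrder A] [StarOrderedRing A] {x z : Std A} {c : ℝ} (hc : 0 ≤ c)
    (h : ∀ a : A, c * ‖op a • x‖ ≤ ‖op a • z‖) :
    c ^ 2 • Std.ip x x ≤ Std.ip z z := by
  set w := Std.ip z z with hw
  have hw0 : 0 ≤ w := Std.ip_self_nonneg z
  have hws : IsSelfAdjoint w := .of_nonneg hw0
  have hspec : ∀ s ∈ spectrum ℝ w, 0 ≤ s := fun s hs => spectrum_nonneg_of_nonneg hw0 hs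
  have key : ∀ ε : ℝ, 0 < ε → c ^ 2 • Std.ip x x ≤ w + algebraMap ℝ A ε := by
    intro ε hε
    have hpos : ∀ s ∈ spectrum ℝ w, 0 < √(s + ε) := fun s hs => by
      have := hspec s hs
      positivity
    let g : A := cfc (fun s : ℝ => √(s + ε)) w
    let k : A := cfc (fun s : ℝ => (√(s + ε))⁻¹) w
    have hkc : ContinuousOn (fun s : ℝ => (√(s + ε))⁻¹) (spectrum ℝ w) :=
      ContinuousOn.inv₀ (by fun_prop) fun s hs => (hpos s hs).ne'
    have hks : star k = k := (cfc_predicate _ w : IsSelfAdjoint k).star_eq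
    have hgs : star g = g := (cfc_predicate _ w : IsSelfAdjoint g).star_eq
    have hkg : k * g = 1 := by
      rw [← cfc_mul _ _ w hkc (by fun_prop), ← cfc_one (R := ℝ) w]
      exact cfc_congr fun s hs => inv_mul_cancel₀ (hpos s hs).ne'
    have hgk : g * k = 1 := by
      rw [← cfc_mul _ _ w (by fun_prop) hkc, ← cfc_one (R := ℝ) w]
      exact cfc_congr fun s hs => mul_inv_cancel₀ (hpos s hs).ne'
    have hgg : g * g = w + algebraMap ℝ A ε := by
      rw [← cfc_mul _ _ w (by fun_prop) (by fun_prop)]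
      have : w + algebraMap ℝ A ε = cfc (fun s : ℝ => s + ε) w := by
        rw [cfc_add_const ε _ w, cfc_id' ℝ w]
      rw [this]
      exact cfc_congr fun s hs => Real.mul_self_sqrt (by have := hspec s hs; positivity)
    have hkwk : ‖k * w * k‖ ≤ 1 := by
      have : k * w * k = cfc (fun s : ℝ => (√(s + ε))⁻¹ * s * (√(s + ε))⁻¹) w := by
        rw [cfc_mul (fun s : ℝ => (√(s + ε))⁻¹ * s) _ w (hkc.mul continuousOn_id) hkc,
          cfc_mul _ (fun s : ℝ => s) w hkc continuousOn_id, cfc_id' ℝ w]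
      rw [this]
      refine norm_cfc_le zero_le_one fun s hs => ?_
      have h0 := hspec s hs
      have h1 : (√(s + ε))⁻¹ * s * (√(s + ε))⁻¹ = s / (s + ε) := by
        rw [mul_right_comm, ← mul_inv, Real.mul_self_sqrt (by positivity), inv_mul_eq_div]
      rw [h1, Real.norm_of_nonneg (by positivity)]
      exact div_le_one_of_le₀ (by linarith) (by positivity)
    have hz : ‖op k • z‖ ≤ 1 := by
      refine le_of_sq_le_sq ?_ zero_le_one
      rw [Std.norm_sq_eq, Std.ip_smul_smul_self, hks]
      simpa using hkwk
    have hx : c ^ 2 • (k * Std.ip x x * k) ≤ 1 := by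
      have h0 : 0 ≤ k * Std.ip x x * k := by
        have := star_left_conjugate_nonneg (Std.ip_self_nonneg x) k
        rwa [hks] at this
      rw [← CStarAlgebra.norm_le_one_iff_of_nonneg _ (smul_nonneg (by positivity) h0), norm_smul,
        Real.norm_of_nonneg (by positivity)]
      have h1 : ‖k * Std.ip x x * k‖ = ‖op k • x‖ ^ 2 := by
        rw [Std.norm_sq_eq, Std.ip_smul_smul_self, hks]
      rw [h1, ← mul_pow]
      exact pow_le_one₀ (by positivity) ((h k).trans hz)
    have := star_left_conjugate_le_conjugate hx g
    rw [hgs, mul_one, hgg, mul_smul_comm, smul_mul_assoc] at this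
    rwa [mul_assoc k, ← mul_assoc g, hgk, one_mul, mul_assoc, hkg, mul_one] at this
  have hlim : Filter.Tendsto (fun ε : ℝ => w + algebraMap ℝ A ε) (nhdsWithin 0 (Set.Ioi 0))
      (nhds w) := by
    have h1 : Continuous fun ε : ℝ => w + algebraMap ℝ A ε :=
      continuous_const.add (algebraMapCLM ℝ A).continuous
    have h2 := h1.tendsto 0
    rw [map_zero, add_zero] at h2
    exact h2.mono_left nhdsWithin_le_nhds
  refine ge_of_tendsto hlim ?_
  filter_upwards [self_mem_nhdsWithin] with ε hε using key ε hε

/-- A coercive operator on `H_A` is invertible: `1 - t S` is a strict contraction for small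
`t > 0`. -/
theorem exists_inverse_of_coercive [PartialOrder A] [StarOrderedRing A]
    (S : Std A →L[Aᵐᵒᵖ] Std A) {d : ℝ} (hd : 0 < d)
    (hS : ∀ x, d • Std.ip x x ≤ Std.ip x (S x)) :
    ∃ T : Std A →L[Aᵐᵒᵖ] Std A, ∀ x, T (S x) = x := by
  obtain ⟨C₀, hC₀, hSC₀⟩ := exists_norm_le S
  -- the constant is enlarged so that `1 - 2 t d ≥ 0` for `t = d / C²`
  set C := max C₀ (2 * d) with hC
  have hCpos : 0 < C := lt_max_of_lt_left hC₀
  have hSC : ∀ x, ‖S x‖ ≤ C * ‖x‖ := fun x => (hSC₀ x).trans (by gcongr; exact le_max_left _ _)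
  set t := d / C ^ 2 with ht
  have htpos : 0 < t := by positivity
  have htd : 2 * t * d ≤ 1 := by
    have h1 : 2 * d ≤ C := le_max_right _ _
    rw [ht, mul_div_assoc', div_mul_eq_mul_div, div_le_one (by positivity)]
    nlinarith
  have htC : t ^ 2 * C ^ 2 = t * d := by
    rw [ht]
    field_simp
  have hcontr : ∀ x, ‖x - (t : ℂ) • S x‖ ≤ √(1 - t * d) * ‖x‖ := fun x => by
    refine le_of_sq_le_sq ?_ (by positivity)
    have h0 : 0 ≤ Std.ip x (S x) := (smul_nonneg hd.le (Std.ip_self_nonneg x)).trans (hS x)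
    have h1 : Std.ip (S x) x = Std.ip x (S x) := by
      rw [← Std.star_ip]
      exact (IsSelfAdjoint.of_nonneg h0).star_eq
    have h2 : Std.ip (x - (t : ℂ) • S x) (x - (t : ℂ) • S x) =
        Std.ip x x - (2 * t) • Std.ip x (S x) + t ^ 2 • Std.ip (S x) (S x) := by
      simp only [Std.ip_sub_left, Std.ip_sub_right, Std.ip_smul_left, Std.ip_smul_right, h1,
        Complex.star_def, Complex.conj_ofReal]
      simp only [Complex.coe_smul]
      module
    have h3 : Std.ip (x - (t : ℂ) • S x) (x - (t : ℂ) • S x) ≤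
        (1 - 2 * t * d) • Std.ip x x + t ^ 2 • Std.ip (S x) (S x) := by
      rw [h2, sub_smul, one_smul, mul_smul (2 * t) d]
      gcongr
      exact hS x
    rw [Std.norm_sq_eq, mul_pow, Real.sq_sqrt (by nlinarith)]
    calc _ ≤ ‖(1 - 2 * t * d) • Std.ip x x + t ^ 2 • Std.ip (S x) (S x)‖ :=
          CStarAlgebra.norm_le_norm_of_nonneg_of_le (Std.ip_self_nonneg _) h3
      _ ≤ (1 - 2 * t * d) * ‖x‖ ^ 2 + t ^ 2 * ‖S x‖ ^ 2 := by
        refine (norm_add_le _ _).trans ?_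
        rw [norm_smul, norm_smul, ← Std.norm_sq_eq, ← Std.norm_sq_eq,
          Real.norm_of_nonneg (by linarith), Real.norm_of_nonneg (by positivity)]
      _ ≤ (1 - 2 * t * d) * ‖x‖ ^ 2 + t ^ 2 * (C * ‖x‖) ^ 2 := by
        gcongr
        exact hSC x
      _ = (1 - t * d) * ‖x‖ ^ 2 := by rw [mul_pow, ← mul_assoc, htC]; ring
  let S' : Std A →L[ℂ] Std A := S.restrictScalars ℂ
  have hnorm : ‖(1 : Std A →L[ℂ] Std A) - (t : ℂ) • S'‖ < 1 := by
    refine lt_of_le_of_lt (ContinuousLinearMap.opNorm_le_bound _ (Real.sqrt_nonneg _) hcontr) ?_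
    rw [Real.sqrt_lt' one_pos]
    nlinarith
  obtain ⟨u, hu⟩ : IsUnit ((t : ℂ) • S') := by
    have := isUnit_one_sub_of_norm_lt_one hnorm
    rwa [sub_sub_cancel] at this
  let V : Std A →L[ℂ] Std A := (t : ℂ) • (↑u⁻¹ : Std A →L[ℂ] Std A)
  have hVS : ∀ x, V (S x) = x := fun x => by
    have h1 : (↑u⁻¹ : Std A →L[ℂ] Std A) * ((t : ℂ) • S') = 1 := by rw [← hu, u.inv_mul]
    have h2 := congrArg (fun R : Std A →L[ℂ] Std A => R x) h1
    simpa [V, S'] using h2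
  have hSV : ∀ x, S (V x) = x := fun x => by
    have h1 : ((t : ℂ) • S') * (↑u⁻¹ : Std A →L[ℂ] Std A) = 1 := by rw [← hu, u.mul_inv]
    have h2 := congrArg (fun R : Std A →L[ℂ] Std A => R x) h1
    change S' (V x) = x
    simpa [V] using h2
  refine ⟨{ toFun := V, map_add' := map_add V, map_smul' := fun a x => ?_,
            cont := V.continuous }, hVS⟩
  change V (a • x) = a • V x
  rw [← hVS (a • V x), map_smul S, hSV]

/-- The operators that are bounded below on the complement of the first `n` coordinates, for some
`n`. -/
def BoundedBelowOnTail (F : Std A →L[Aᵐᵒᵖ] Std A) : Prop :=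
  ∃ (n : ℕ) (c : ℝ), 0 < c ∧ ∀ x, restr A (Set.Iio n) x = 0 → c * ‖x‖ ≤ ‖F x‖

/-- An adjointable operator that is bounded below on the complement of the first `n` coordinates
has a left inverse there, namely `S⁻¹ F*` for the coercive operator `S = F* F` on the complement. -/
theorem exists_leftInverse {F : Std A →L[Aᵐᵒᵖ] Std A} (hF : IsAdjointable F) {n : ℕ} {c : ℝ}
    (hc : 0 < c) (h : ∀ x, restr A (Set.Iio n) x = 0 → c * ‖x‖ ≤ ‖F x‖) :
    ∃ G : Std A →L[Aᵐᵒᵖ] Std A, (∀ x, restr A (Set.Iio n) x = 0 → G (F x) = x) ∧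
      ∀ y, restr A (Set.Iio n) (G y) = 0 := by
  let _ := CStarAlgebra.spectralOrder A
  have _ := CStarAlgebra.spectralOrderedRing A
  obtain ⟨F', hF'⟩ := hF
  let P := restr A (Set.Iio n)
  let Q := restr A (Set.Iio n)ᶜ
  have hPQ : ∀ x, P (Q x) = 0 := fun x => by
    change restr A _ (restr A _ x) = 0
    rw [restr_restr, Set.inter_compl_self, restr_empty]
  have hQ : ∀ x, P x = 0 → Q x = x := fun x hx => by
    have : P x + Q x = x := restr_add_restr_compl _ x
    rwa [hx, zero_add] at this
  let S : Std A →L[Aᵐᵒᵖ] Std A := Q ∘L F' ∘L F ∘L Q + P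
  have hS : ∀ x, S x = Q (F' (F (Q x))) + P x := fun x => rfl
  have hcoer : ∀ x, (min (c ^ 2) 1) • Std.ip x x ≤ Std.ip x (S x) := fun x => by
    have e1 : Std.ip x (S x) = Std.ip (F (Q x)) (F (Q x)) + Std.ip (P x) (P x) := by
      rw [hS, Std.ip_add_right, ← ip_restr_left, hF', ip_restr_restr]
    have e2 : Std.ip x x = Std.ip (Q x) (Q x) + Std.ip (P x) (P x) := by
      rw [ip_restr_restr, ip_restr_restr, ← Std.ip_add_right, add_comm, restr_add_restr_compl]
    have e3 : c ^ 2 • Std.ip (Q x) (Q x) ≤ Std.ip (F (Q x)) (F (Q x)) :=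
      smul_ip_self_le hc.le fun a => by
        have := h (Q (op a • x)) (hPQ _)
        rwa [map_smul, map_smul] at this
    rw [e1, e2, smul_add]
    refine add_le_add (le_trans ?_ e3) ?_
    · exact smul_le_smul_of_nonneg_right (min_le_left _ _) (Std.ip_self_nonneg _)
    · conv_rhs => rw [← one_smul ℝ (Std.ip (P x) (P x))]
      exact smul_le_smul_of_nonneg_right (min_le_right _ _) (Std.ip_self_nonneg _)
  obtain ⟨T, hT⟩ := exists_inverse_of_coercive S (by positivity) hcoer
  refine ⟨Q ∘L T ∘L Q ∘L F', fun x hx => ?_, fun y => hPQ _⟩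
  change Q (T (Q (F' (F x)))) = x
  have : Q (F' (F x)) = S x := by
    rw [hS, hQ x hx, show P x = 0 from hx, add_zero]
  rw [this, hT, hQ x hx]

/-- If `G` is a left inverse of `F` on the complement of the first `n` coordinates, then the range
of `1 - G F` is generated by the images of `n` basis vectors. -/
theorem sub_leftInverse_eq_sum {F G : Std A →L[Aᵐᵒᵖ] Std A} {n : ℕ}
    (hG : ∀ x, restr A (Set.Iio n) x = 0 → G (F x) = x) (x : Std A) :
    x - G (F x) = ∑ i : Fin n, op (x i) • (basisVec A i - G (F (basisVec A i))) := by
  have h1 : x = restr A (Set.Iio n) x + restr A (Set.Iio n)ᶜ x :=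
    (restr_add_restr_compl _ x).symm
  have h2 : G (F (restr A (Set.Iio n)ᶜ x)) = restr A (Set.Iio n)ᶜ x := hG _ (by
    rw [restr_restr, Set.inter_compl_self, restr_empty])
  calc x - G (F x) = restr A (Set.Iio n) x - G (F (restr A (Set.Iio n) x)) := by
        conv_lhs => rw [h1]
        rw [map_add, map_add, h2]
        abel
    _ = _ := by
        rw [restr_Iio_eq_sum]
        simp only [map_sum, map_smul, smul_sub, Finset.sum_sub_distrib]

/-- An adjointable operator bounded below on a tail is upper semi-Fredholm: with `G` a left inverse
on the tail, the decompositions are those of the idempotents `G F` and `F G`. -/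
theorem BoundedBelowOnTail.isUpperSemiFredholm {F : Std A →L[Aᵐᵒᵖ] Std A} (hF : IsAdjointable F)
    (h : BoundedBelowOnTail F) : IsUpperSemiFredholm F := by
  obtain ⟨n, c, hc, hFc⟩ := h
  obtain ⟨G, hG, hPG⟩ := exists_leftInverse hF hc hFc
  have hGFG : ∀ y, G (F (G y)) = G y := fun y => hG _ (hPG y)
  have hcl : ∀ T : Std A →L[Aᵐᵒᵖ] Std A, IsClosed (T.toLinearMap.ker : Set (Std A)) := fun T =>
    T.isClosed_ker
  let M₁ : Submodule Aᵐᵒᵖ (Std A) := (restr A (Set.Iio n)).toLinearMap.ker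
  let N₁ : Submodule Aᵐᵒᵖ (Std A) := (G ∘L F).toLinearMap.ker
  let M₂ : Submodule Aᵐᵒᵖ (Std A) :=
    (.id Aᵐᵒᵖ (Std A) - F ∘L G : Std A →L[Aᵐᵒᵖ] Std A).toLinearMap.ker
  let N₂ : Submodule Aᵐᵒᵖ (Std A) := G.toLinearMap.ker
  have mM₁ : ∀ x, x ∈ M₁ ↔ restr A (Set.Iio n) x = 0 := fun x => Iff.rfl
  have mN₁ : ∀ x, x ∈ N₁ ↔ G (F x) = 0 := fun x => Iff.rfl
  have mM₂ : ∀ x, x ∈ M₂ ↔ F (G x) = x := fun x => sub_eq_zero.trans eq_comm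
  have mN₂ : ∀ x, x ∈ N₂ ↔ G x = 0 := fun x => Iff.rfl
  refine ⟨hF, M₁, N₁, M₂, N₂, hcl _, hcl _, hcl _, hcl _, ?_, ?_, ?_, ?_, ?_⟩
  · refine isCompl_iff.2 ⟨Submodule.disjoint_def.2 fun x h1 h2 => ?_,
      codisjoint_iff.2 (eq_top_iff.2 fun x _ => Submodule.mem_sup.2 ?_)⟩
    · rw [mM₁] at h1
      rw [mN₁, hG x h1] at h2
      exact h2
    · refine ⟨G (F x), (mM₁ _).2 (hPG _), x - G (F x), (mN₁ _).2 ?_, add_sub_cancel _ _⟩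
      rw [map_sub, map_sub, hGFG, sub_self]
  · refine isCompl_iff.2 ⟨Submodule.disjoint_def.2 fun x h1 h2 => ?_,
      codisjoint_iff.2 (eq_top_iff.2 fun x _ => Submodule.mem_sup.2 ?_)⟩
    · rw [mM₂] at h1
      rw [mN₂] at h2
      rw [← h1, h2, map_zero]
    · refine ⟨F (G x), (mM₂ _).2 (by rw [hGFG]), x - F (G x), (mN₂ _).2 ?_, add_sub_cancel _ _⟩
      rw [map_sub, hGFG, sub_self]
  · refine ⟨ContinuousLinearEquiv.equivOfInverse
      ((F ∘L M₁.subtypeL).codRestrict M₂ fun x => (mM₂ _).2 (congrArg F (hG _ x.2)))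
      ((G ∘L M₂.subtypeL).codRestrict M₁ fun x => (mM₁ _).2 (hPG _))
      (fun x => Subtype.ext (hG _ x.2)) (fun x => Subtype.ext ((mM₂ _).1 x.2)), fun x => rfl⟩
  · exact fun x hx => hx
  · rw [Submodule.fg_iff_exists_fin_generating_family]
    refine ⟨n, fun i => basisVec A i - G (F (basisVec A i)),
      le_antisymm (Submodule.span_le.2 ?_) fun x hx => ?_⟩
    · rintro _ ⟨i, rfl⟩
      refine (mN₁ _).2 ?_
      rw [map_sub, map_sub, hGFG, sub_self]
    · have := sub_leftInverse_eq_sum hG x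
      rw [(mN₁ x).1 hx, sub_zero] at this
      rw [this]
      exact Submodule.sum_mem _ fun i _ => Submodule.smul_mem _ _ (Submodule.subset_span ⟨i, rfl⟩)

/-- Over a W⋆-algebra, an adjointable operator bounded below on a tail has a finitely generated
kernel: with `G` a left inverse on the tail, the kernel is the image of the module of relations
between the finitely many vectors `F (1 - G F) eᵢ`. -/
theorem BoundedBelowOnTail.fg_ker [WStarAlgebra A] {F : Std A →L[Aᵐᵒᵖ] Std A}
    (hF : IsAdjointable F) (h : BoundedBelowOnTail F) : F.toLinearMap.ker.FG := by
  obtain ⟨n, c, hc, hFc⟩ := h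
  obtain ⟨G, hG, -⟩ := exists_leftInverse hF hc hFc
  let b : Fin n → Std A := fun i => basisVec A i - G (F (basisVec A i))
  let comb : (Fin n → Std A) → (Fin n → A) →ₗ[Aᵐᵒᵖ] Std A := fun v =>
    { toFun := fun a => ∑ i, op (a i) • v i
      map_add' := fun a a' => by
        simp only [Pi.add_apply, op_add, add_smul, Finset.sum_add_distrib]
      map_smul' := fun r a => by
        simp only [Pi.smul_apply, RingHom.id_apply, Finset.smul_sum, smul_smul]
        rfl }
  have hcomb : ∀ a, F (comb b a) = comb (fun i => F (b i)) a := fun a => by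
    change F (∑ i, op (a i) • b i) = ∑ i, op (a i) • F (b i)
    simp only [map_sum, map_smul]
  have hL := fg_of_relations (fun i => F (b i)) (comb fun i => F (b i)).ker fun a => Iff.rfl
  have : F.toLinearMap.ker = (comb fun i => F (b i)).ker.map (comb b) := by
    ext x
    rw [Submodule.mem_map]
    constructor
    · intro hx
      have hx' : F x = 0 := hx
      have h1 : x = comb b fun i => x i := by
        have := sub_leftInverse_eq_sum hG x
        rwa [hx', map_zero, sub_zero] at this
      refine ⟨fun i => x i, ?_, h1.symm⟩
      rw [LinearMap.mem_ker, ← hcomb, ← h1, hx']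
    · rintro ⟨a, ha, rfl⟩
      exact (hcomb a).trans ha
  rw [this]
  exact hL.map _

/-! ### Tails, Fredholm decompositions and compact perturbations -/

theorem restr_eq_zero_of_subset {s t : Set ℕ} (hst : s ⊆ t) {x : Std A} (hx : restr A t x = 0) :
    restr A s x = 0 := by
  rw [← Set.inter_eq_left.2 hst, ← restr_restr, hx, map_zero]

theorem restr_compl_eq_self {s : Set ℕ} {x : Std A} (hx : restr A s x = 0) :
    restr A sᶜ x = x := by
  conv_rhs => rw [← restr_add_restr_compl s x, hx, zero_add]

/-- The map `a ↦ x a` from `A` to `H_A`. -/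
def opSmulL (x : Std A) : A →L[ℂ] Std A :=
  LinearMap.mkContinuous
    { toFun := fun a => op a • x
      map_add' := fun a b => by rw [op_add, add_smul]
      map_smul' := fun c a => by rw [op_smul, smul_assoc, RingHom.id_apply] } ‖x‖ fun a => by
    rw [mul_comm]; exact Std.norm_op_smul_le (op a) x

/-- On a closed finitely generated submodule the tails are uniformly small: by the open mapping
theorem every element is a combination of the generators with controlled coefficients. -/
theorem exists_tail_le_of_fg {N : Submodule Aᵐᵒᵖ (Std A)} (hN : IsClosed (N : Set (Std A)))
    (hfg : N.FG) {ε : ℝ} (hε : 0 < ε) :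
    ∃ n, ∀ x ∈ N, ‖restr A (Set.Iio n)ᶜ x‖ ≤ ε * ‖x‖ := by
  obtain ⟨m, v, hv⟩ := Submodule.fg_iff_exists_fin_generating_family.1 hfg
  let N' : Submodule ℂ (Std A) := N.restrictScalars ℂ
  have : CompleteSpace N' := hN.completeSpace_coe
  let g : (Fin m → A) →L[ℂ] Std A := ∑ i, (opSmulL (v i)).comp (ContinuousLinearMap.proj i)
  have hg : ∀ a, g a = ∑ i, op (a i) • v i := fun a => by
    simp only [g, sum_apply]
    rfl
  have hgN : ∀ a, g a ∈ N' := fun a => by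
    rw [hg]
    exact Submodule.sum_mem N fun i _ =>
      Submodule.smul_mem _ _ (hv ▸ Submodule.subset_span ⟨i, rfl⟩)
  have hsurj : Function.Surjective (g.codRestrict N' hgN) := fun ⟨x, hx⟩ => by
    have hx' : x ∈ Submodule.span Aᵐᵒᵖ (Set.range v) := by rw [hv]; exact hx
    obtain ⟨c, hc⟩ := (Submodule.mem_span_range_iff_exists_fun Aᵐᵒᵖ).1 hx'
    exact ⟨fun i => unop (c i), Subtype.ext ((hg _).trans hc)⟩
  obtain ⟨C, hC, hpre⟩ := ContinuousLinearMap.exists_preimage_norm_le _ hsurj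
  have hlim : Filter.Tendsto (fun n => C * ∑ i, ‖restr A (Set.Iio n)ᶜ (v i)‖) Filter.atTop
      (nhds 0) := by
    have := (tendsto_finsetSum Finset.univ fun i _ => (tendsto_restr_Ici (v i)).norm).const_mul C
    simpa using this
  obtain ⟨n, hn⟩ := (hlim.eventually (gt_mem_nhds hε)).exists
  refine ⟨n, fun x hx => ?_⟩
  obtain ⟨a, ha, hax⟩ := hpre ⟨x, hx⟩
  have hxa : x = ∑ i, op (a i) • v i :=
    ((hg a).symm.trans (congrArg Subtype.val ha)).symm
  calc ‖restr A (Set.Iio n)ᶜ x‖ = ‖∑ i, op (a i) • restr A (Set.Iio n)ᶜ (v i)‖ := by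
        rw [hxa]; simp only [map_sum, map_smul]
    _ ≤ ∑ i, (C * ‖x‖) * ‖restr A (Set.Iio n)ᶜ (v i)‖ := by
        refine norm_sum_le_of_le _ fun i _ => (Std.norm_op_smul_le _ _).trans ?_
        gcongr
        rw [norm_op]
        exact (norm_le_pi_norm a i).trans hax
    _ = (C * ∑ i, ‖restr A (Set.Iio n)ᶜ (v i)‖) * ‖x‖ := by rw [← Finset.mul_sum]; ring
    _ ≤ ε * ‖x‖ := by gcongr

/-- The components of a vector in a direct sum of closed submodules are bounded by its norm. -/
theorem exists_decomposition_le {M N : Submodule Aᵐᵒᵖ (Std A)} (hM : IsClosed (M : Set (Std A)))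
    (hN : IsClosed (N : Set (Std A))) (h : IsCompl M N) :
    ∃ C, 0 < C ∧ ∀ x, ∃ y ∈ M, ∃ z ∈ N, y + z = x ∧ ‖y‖ ≤ C * ‖x‖ ∧ ‖z‖ ≤ C * ‖x‖ := by
  let M' : Submodule ℂ (Std A) := M.restrictScalars ℂ
  let N' : Submodule ℂ (Std A) := N.restrictScalars ℂ
  have : CompleteSpace M' := hM.completeSpace_coe
  have : CompleteSpace N' := hN.completeSpace_coe
  have hsurj : Function.Surjective (M'.subtypeL.coprod N'.subtypeL) := fun x => by
    have hx : x ∈ M ⊔ N := by rw [h.sup_eq_top]; trivial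
    obtain ⟨y, hy, z, hz, rfl⟩ := Submodule.mem_sup.1 hx
    exact ⟨(⟨y, hy⟩, ⟨z, hz⟩), rfl⟩
  obtain ⟨C, hC, hpre⟩ := ContinuousLinearMap.exists_preimage_norm_le _ hsurj
  refine ⟨C, hC, fun x => ?_⟩
  obtain ⟨⟨y, z⟩, hyz, hle⟩ := hpre x
  exact ⟨y, y.2, z, z.2, hyz, (norm_fst_le (y, z)).trans hle, (norm_snd_le (y, z)).trans hle⟩

/-- An upper semi-Fredholm operator is bounded below on a tail, since the tails of vectors of the
finitely generated summand `N₁` are uniformly small. -/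
theorem IsUpperSemiFredholm.boundedBelowOnTail {F : Std A →L[Aᵐᵒᵖ] Std A}
    (h : IsUpperSemiFredholm F) : BoundedBelowOnTail F := by
  obtain ⟨-, M₁, N₁, M₂, N₂, hM₁, hN₁, hM₂, hN₂, h₁, h₂, ⟨e, he⟩, hFN, hfg⟩ := h
  obtain ⟨C₁, hC₁, hdec₁⟩ := exists_decomposition_le hM₁ hN₁ h₁
  obtain ⟨C₂, hC₂, hdec₂⟩ := exists_decomposition_le hM₂ hN₂ h₂
  obtain ⟨D, hD, heD⟩ : ∃ D, 0 < D ∧ ∀ y : M₂, ‖e.symm y‖ ≤ D * ‖y‖ :=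
    ((e.symm : M₂ →L[Aᵐᵒᵖ] M₁).restrictScalars ℂ).bound
  obtain ⟨n, hn⟩ := exists_tail_le_of_fg hN₁ hfg (ε := 1 / (2 * C₁)) (by positivity)
  refine ⟨n, 1 / (2 * D * C₂), by positivity, fun x hx => ?_⟩
  obtain ⟨y, hy, z, hz, hyz, -, hzx⟩ := hdec₁ x
  obtain ⟨y', hy', z', hz', hyz', hyx', -⟩ := hdec₂ (F x)
  have hFy : F y = y' := by
    have hmem : F y ∈ M₂ := by rw [← he ⟨y, hy⟩]; exact (e ⟨y, hy⟩).2
    have h3 : F y - y' = z' - F z := by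
      rw [sub_eq_sub_iff_add_eq_add, ← map_add, hyz, ← hyz', add_comm]
    have h4 : F y - y' ∈ N₂ := h3 ▸ sub_mem hz' (hFN z hz)
    exact sub_eq_zero.1 (Submodule.disjoint_def.1 h₂.disjoint _ (sub_mem hmem hy') h4)
  have h5 : ‖y‖ ≤ D * ‖y'‖ := by
    have h6 := heD (e ⟨y, hy⟩)
    rw [ContinuousLinearEquiv.symm_apply_apply, ← hFy] at *
    rw [← he ⟨y, hy⟩]
    exact h6
  have h7 : ‖x‖ ≤ ‖y‖ + ‖x‖ / 2 := by
    calc ‖x‖ = ‖restr A (Set.Iio n)ᶜ y + restr A (Set.Iio n)ᶜ z‖ := by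
          rw [← map_add, hyz, restr_compl_eq_self hx]
      _ ≤ ‖y‖ + 1 / (2 * C₁) * (C₁ * ‖x‖) := by
          refine norm_add_le_of_le (norm_restr_le _ _) ((hn z hz).trans ?_)
          gcongr
      _ = ‖y‖ + ‖x‖ / 2 := by field_simp
  have h8 : ‖x‖ ≤ 2 * D * C₂ * ‖F x‖ := by
    calc ‖x‖ ≤ 2 * ‖y‖ := by linarith
      _ ≤ 2 * (D * (C₂ * ‖F x‖)) := by gcongr; exact h5.trans (by gcongr)
      _ = _ := by ring
  rw [one_div, inv_mul_le_iff₀ (by positivity)]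
  exact h8

/-- Compact operators are small on tails. -/
theorem IsCompactAdjointable.exists_le_on_tail {K : Std A →L[Aᵐᵒᵖ] Std A}
    (hK : IsCompactAdjointable K) {ε : ℝ} (hε : 0 < ε) :
    ∃ n, ∀ m ≥ n, ∀ x, restr A (Set.Iio m) x = 0 → ‖K x‖ ≤ ε * ‖x‖ := by
  obtain ⟨k, u, v, huv⟩ := hK.2 (ε / 2) (by positivity)
  have hlim : Filter.Tendsto (fun n => ∑ j, ‖u j‖ * ‖restr A (Set.Iio n)ᶜ (v j)‖) Filter.atTop
      (nhds 0) := by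
    have := tendsto_finsetSum Finset.univ fun j _ =>
      (tendsto_restr_Ici (v j)).norm.const_mul ‖u j‖
    simpa using this
  obtain ⟨n, hn⟩ := Filter.eventually_atTop.1 (hlim.eventually (gt_mem_nhds (half_pos hε)))
  refine ⟨n, fun m hm x hx => ?_⟩
  have h1 : ‖(∑ j, rankOne (u j) (v j)) x‖ ≤
      (∑ j, ‖u j‖ * ‖restr A (Set.Iio m)ᶜ (v j)‖) * ‖x‖ := by
    rw [sum_apply, Finset.sum_mul]
    refine norm_sum_le_of_le _ fun j _ => ?_
    have h2 : Std.ip (v j) x = Std.ip (restr A (Set.Iio m)ᶜ (v j)) x := by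
      rw [ip_restr_left, restr_compl_eq_self hx]
    calc ‖op (Std.ip (v j) x) • u j‖ ≤ ‖op (Std.ip (v j) x)‖ * ‖u j‖ := Std.norm_op_smul_le _ _
      _ ≤ (‖restr A (Set.Iio m)ᶜ (v j)‖ * ‖x‖) * ‖u j‖ := by
        gcongr
        rw [norm_op, h2]
        exact Std.norm_ip_le _ _
      _ = _ := by ring
  calc ‖K x‖ = ‖(K x - (∑ j, rankOne (u j) (v j)) x) + (∑ j, rankOne (u j) (v j)) x‖ := by
        rw [sub_add_cancel]
    _ ≤ ε / 2 * ‖x‖ + ε / 2 * ‖x‖ := by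
        refine norm_add_le_of_le (huv x) (h1.trans ?_)
        gcongr
        exact (hn m hm).le
    _ = ε * ‖x‖ := by ring

theorem BoundedBelowOnTail.sub_compact {F K : Std A →L[Aᵐᵒᵖ] Std A} (hF : BoundedBelowOnTail F)
    (hK : IsCompactAdjointable K) : BoundedBelowOnTail (F - K) := by
  obtain ⟨n, c, hc, hFc⟩ := hF
  obtain ⟨m, hm⟩ := hK.exists_le_on_tail (half_pos hc)
  refine ⟨max n m, c / 2, by positivity, fun x hx => ?_⟩
  have h1 := hFc x (restr_eq_zero_of_subset (Set.Iio_subset_Iio (le_max_left _ _)) hx)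
  have h2 := hm _ (le_max_right n m) x hx
  have h3 := norm_sub_norm_le (F x) (K x)
  change _ ≤ ‖F x - K x‖
  linarith

theorem IsAdjointable.sub {F K : Std A →L[Aᵐᵒᵖ] Std A} (hF : IsAdjointable F)
    (hK : IsAdjointable K) : IsAdjointable (F - K) := by
  obtain ⟨F', hF'⟩ := hF
  obtain ⟨K', hK'⟩ := hK
  refine ⟨F' - K', fun x y => ?_⟩
  change Std.ip (F x - K x) y = Std.ip x (F' y - K' y)
  rw [Std.ip_sub_left, Std.ip_sub_right, hF', hK']

/-! ### Compact operators that agree with `F` far out -/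

/-- The operator `∑ θ_{u k, v k}`, for sequences with `∑ ‖u k‖ ‖v k‖ < ∞`. -/
theorem exists_hasSum_rankOne {u v : ℕ → Std A} (h : Summable fun k => ‖u k‖ * ‖v k‖) :
    ∃ K : Std A →L[Aᵐᵒᵖ] Std A, ∀ z, HasSum (fun k => rankOne (u k) (v k) z) (K z) := by
  have hle : ∀ z k, ‖rankOne (u k) (v k) z‖ ≤ (‖u k‖ * ‖v k‖) * ‖z‖ := fun z k => by
    calc ‖op (Std.ip (v k) z) • u k‖ ≤ ‖op (Std.ip (v k) z)‖ * ‖u k‖ := Std.norm_op_smul_le _ _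
      _ ≤ (‖v k‖ * ‖z‖) * ‖u k‖ := by rw [norm_op]; gcongr; exact Std.norm_ip_le _ _
      _ = _ := by ring
  have hs : ∀ z, Summable fun k => rankOne (u k) (v k) z := fun z =>
    .of_norm_bounded (h.mul_right ‖z‖) (hle z)
  let K : Std A →ₗ[Aᵐᵒᵖ] Std A :=
    { toFun := fun z => ∑' k, rankOne (u k) (v k) z
      map_add' := fun z w => by
        simp only [map_add]
        exact (hs z).tsum_add (hs w)
      map_smul' := fun a z => by
        simp only [map_smul, RingHom.id_apply]
        let f : Std A →+ Std A := DistribSMul.toAddMonoidHom _ a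
        have hf : Continuous f :=
          AddMonoidHomClass.continuous_of_bound f ‖a‖ (Std.norm_op_smul_le a)
        exact ((hs z).hasSum.map f hf).tsum_eq }
  refine ⟨⟨K, AddMonoidHomClass.continuous_of_bound K (∑' k, ‖u k‖ * ‖v k‖) fun z => ?_⟩,
    fun z => (hs z).hasSum⟩
  exact tsum_of_norm_bounded (h.hasSum.mul_right ‖z‖) (hle z)

theorem exists_compact_hasSum {u v : ℕ → Std A} (h : Summable fun k => ‖u k‖ * ‖v k‖) :
    ∃ K : Std A →L[Aᵐᵒᵖ] Std A, IsCompactAdjointable K ∧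
      ∀ z, HasSum (fun k => rankOne (u k) (v k) z) (K z) := by
  obtain ⟨K, hK⟩ := exists_hasSum_rankOne h
  obtain ⟨K', hK'⟩ := exists_hasSum_rankOne (h.congr fun k => mul_comm _ _)
  refine ⟨K, ⟨⟨K', fun x y => ?_⟩, fun ε hε => ?_⟩, hK⟩
  · have h1 := ((hK x).mapL (Std.ipL y)).star
    have h2 := (hK' y).mapL (Std.ipL x)
    rw [Std.ipL_apply, Std.star_ip] at h1
    refine h1.unique (h2.congr_fun fun k => ?_)
    change star (Std.ip y (op (Std.ip (v k) x) • u k)) = Std.ip x (op (Std.ip (u k) y) • v k)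
    rw [Std.ip_op_smul_right, Std.ip_op_smul_right, star_mul, unop_op, unop_op, Std.star_ip,
      Std.star_ip]
  · obtain ⟨n, hn⟩ := ((tendsto_sum_nat_add fun k => ‖u k‖ * ‖v k‖).eventually
      (gt_mem_nhds hε)).exists
    refine ⟨n, fun j => u j, fun j => v j, fun z => ?_⟩
    rw [sum_apply,
      Fin.sum_univ_eq_sum_range (fun k => rankOne (u k) (v k) z) n]
    have h1 := (hasSum_nat_add_iff' n).2 (hK z)
    rw [← h1.tsum_eq]
    have h2 := ((summable_nat_add_iff n).2 h).hasSum.mul_right ‖z‖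
    refine (tsum_of_norm_bounded h2 fun k => ?_).trans ?_
    · calc ‖op (Std.ip (v (k + n)) z) • u (k + n)‖
            ≤ ‖op (Std.ip (v (k + n)) z)‖ * ‖u (k + n)‖ := Std.norm_op_smul_le _ _
        _ ≤ (‖v (k + n)‖ * ‖z‖) * ‖u (k + n)‖ := by
          rw [norm_op]; gcongr; exact Std.norm_ip_le _ _
        _ = _ := by ring
    · gcongr

/-- If `F` is not bounded below on any tail, then there is a finitely supported `x` far out with
`F x` small, and an `a ≠ 0` on which `⟨x, x⟩` acts as the identity. Such `x` and `a` arise from a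
unit vector `y` with `F y` small by functional calculus: `x = y h(⟨y, y⟩)` and `a = g(⟨y, y⟩)`
with `h(s) = max(s, 1/2)^(-1/2)` and `g(s) = max(0, 2 s - 1)`. -/
theorem exists_almostKernel_of_not_boundedBelowOnTail {F : Std A →L[Aᵐᵒᵖ] Std A}
    (hF : ¬ BoundedBelowOnTail F) (n : ℕ) {c : ℝ} (hc : 0 < c) :
    ∃ N > n, ∃ (x : Std A) (a : A), restr A (Set.Ico n N) x = x ∧ ‖x‖ ≤ 1 ∧ ‖F x‖ ≤ c ∧
      Std.ip x x * a = a ∧ a ≠ 0 := by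
  let _ := CStarAlgebra.spectralOrder A
  have _ := CStarAlgebra.spectralOrderedRing A
  unfold BoundedBelowOnTail at hF
  push Not at hF
  obtain ⟨x₀, hx₀, hFx₀⟩ := hF n (c / 2) (by positivity)
  have hlim : Filter.Tendsto (fun N => restr A (Set.Iio N) x₀) Filter.atTop (nhds x₀) := by
    have := (tendsto_restr_Ici x₀).const_sub x₀
    rw [sub_zero] at this
    refine this.congr fun N => ?_
    rw [sub_eq_iff_eq_add, restr_add_restr_compl]
  have hev := ((F.continuous.tendsto x₀).comp hlim).norm.eventually_lt
    (hlim.norm.const_mul (c / 2)) hFx₀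
  obtain ⟨N, hN, hNn⟩ := (hev.and (Filter.eventually_gt_atTop n)).exists
  simp only [Function.comp_apply] at hN
  set x₁ := restr A (Set.Iio N) x₀ with hx₁
  have hx₁s : restr A (Set.Ico n N) x₁ = x₁ := by
    have h1 : restr A (Set.Iio n)ᶜ x₀ = x₀ := restr_compl_eq_self hx₀
    have h2 : x₁ = restr A (Set.Ico n N) x₀ := by
      have hset : Set.Iio N ∩ (Set.Iio n)ᶜ = Set.Ico n N := by
        ext i
        simp [and_comm]
      rw [← hset, ← restr_restr, h1]
    rw [h2, restr_restr, Set.inter_self]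
  have hpos : 0 < ‖x₁‖ := by
    have := (norm_nonneg _).trans_lt hN
    exact pos_of_mul_pos_right this (by positivity)
  set y : Std A := ((‖x₁‖⁻¹ : ℝ) : ℂ) • x₁ with hyx
  have hy1 : ‖y‖ = 1 := by
    rw [hyx, norm_smul, Complex.norm_real, Real.norm_of_nonneg (by positivity),
      inv_mul_cancel₀ hpos.ne']
  have hFy : ‖F y‖ ≤ c / 2 := by
    have : F y = ((‖x₁‖⁻¹ : ℝ) : ℂ) • F x₁ := map_smul (F.restrictScalars ℂ) _ _
    rw [this, norm_smul, Complex.norm_real, Real.norm_of_nonneg (by positivity),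
      inv_mul_le_iff₀ hpos, mul_comm]
    exact hN.le
  have hys : restr A (Set.Ico n N) y = y := by
    have : restr A (Set.Ico n N) y = ((‖x₁‖⁻¹ : ℝ) : ℂ) • restr A (Set.Ico n N) x₁ :=
      map_smul ((restr A (Set.Ico n N)).restrictScalars ℂ) _ _
    rw [this, hx₁s]
  set w := Std.ip y y with hw
  have hw0 : 0 ≤ w := Std.ip_self_nonneg y
  have hws : IsSelfAdjoint w := .of_nonneg hw0
  have hw1 : ‖w‖ = 1 := by rw [← Std.norm_sq_eq, hy1, one_pow]
  have hspec : ∀ s ∈ spectrum ℝ w, 0 ≤ s := fun s hs => spectrum_nonneg_of_nonneg hw0 hs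
  have : Nontrivial A := ⟨w, 0, fun h => by simp [h] at hw1⟩
  have hmem : (1 : ℝ) ∈ spectrum ℝ w := hw1 ▸ CStarAlgebra.norm_mem_spectrum_of_nonneg hw0
  have hmax : ∀ s : ℝ, 0 < √(max s (1 / 2)) := fun s =>
    Real.sqrt_pos.2 (lt_max_of_lt_right (by norm_num))
  have hhc : Continuous fun s : ℝ => (√(max s (1 / 2)))⁻¹ :=
    Continuous.inv₀ (by fun_prop) fun s => (hmax s).ne'
  have hgc : Continuous fun s : ℝ => max 0 (2 * s - 1) := by fun_prop
  let h : A := cfc (fun s : ℝ => (√(max s (1 / 2)))⁻¹) w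
  let g : A := cfc (fun s : ℝ => max 0 (2 * s - 1)) w
  have hhs : star h = h := (cfc_predicate _ w : IsSelfAdjoint h).star_eq
  have hh2 : ‖h‖ ≤ 2 := norm_cfc_le zero_le_two fun s hs => by
    rw [Real.norm_of_nonneg (inv_nonneg.2 (hmax s).le)]
    refine inv_le_of_inv_le₀ zero_lt_two ?_
    refine Real.le_sqrt_of_sq_le (le_max_of_le_right (by norm_num))
  have hwh : star h * w * h = cfc (fun s : ℝ => s / max s (1 / 2)) w := by
    have : ∀ s : ℝ, s / max s (1 / 2) = (√(max s (1 / 2)))⁻¹ * s * (√(max s (1 / 2)))⁻¹ :=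
      fun s => by
        rw [mul_right_comm, ← mul_inv, Real.mul_self_sqrt (le_max_of_le_right (by norm_num)),
          inv_mul_eq_div]
    simp only [this]
    rw [cfc_mul (fun s : ℝ => (√(max s (1 / 2)))⁻¹ * s) _ w
      (hhc.mul continuous_id).continuousOn hhc.continuousOn,
      cfc_mul _ (fun s : ℝ => s) w hhc.continuousOn continuousOn_id, cfc_id' ℝ w, hhs]
  have hip : Std.ip (op h • y) (op h • y) = cfc (fun s : ℝ => s / max s (1 / 2)) w := by
    rw [Std.ip_smul_smul_self, hwh]
  refine ⟨N, hNn, op h • y, g, by rw [map_smul, hys], ?_, ?_, ?_, ?_⟩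
  · refine le_of_sq_le_sq ?_ zero_le_one
    rw [Std.norm_sq_eq, hip, one_pow]
    refine norm_cfc_le zero_le_one fun s hs => ?_
    have h0 := hspec s hs
    rw [Real.norm_of_nonneg (by positivity)]
    exact div_le_one_of_le₀ (le_max_left _ _) (by positivity)
  · rw [map_smul]
    calc ‖op h • F y‖ ≤ ‖op h‖ * ‖F y‖ := Std.norm_op_smul_le _ _
      _ ≤ 2 * (c / 2) := by rw [norm_op]; gcongr
      _ = c := by ring
  · have hc' : Continuous fun s : ℝ => s / max s (1 / 2) :=
      continuous_id.div (by fun_prop) fun s => (lt_max_of_lt_right (by norm_num)).ne'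
    rw [hip, ← cfc_mul _ _ w hc'.continuousOn hgc.continuousOn]
    refine cfc_congr fun s _ => ?_
    rcases le_total s (1 / 2) with hs | hs
    · simp only [max_eq_left (by linarith : 2 * s - 1 ≤ 0), mul_zero]
    · simp only [max_eq_left hs]
      rw [div_self (by linarith), one_mul]
  · intro hg0
    have := norm_apply_le_norm_cfc (fun s : ℝ => max 0 (2 * s - 1)) w hmem hgc.continuousOn
    rw [show cfc (fun s : ℝ => max 0 (2 * s - 1)) w = 0 from hg0, norm_zero] at this
    norm_num at this

/-- If `F` is not bounded below on any tail, then `F` agrees with some compact operator on vectors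
that reach arbitrarily far out, so that the kernel of the difference is not finitely generated. -/
theorem boundedBelowOnTail_of_fg_ker {F : Std A →L[Aᵐᵒᵖ] Std A}
    (h : ∀ K : Std A →L[Aᵐᵒᵖ] Std A, IsCompactAdjointable K → (F - K).toLinearMap.ker.FG) :
    BoundedBelowOnTail F := by
  by_contra hF
  choose N hN x a hxs hx1 hFx hxa ha0 using fun (n k : ℕ) =>
    exists_almostKernel_of_not_boundedBelowOnTail hF n (c := (1 / 2) ^ k) (by positivity)
  let p : ℕ → ℕ := fun k => Nat.rec 0 (fun k n => N n k) k
  have hp : ∀ k, p (k + 1) = N (p k) k := fun k => rfl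
  have hmono : StrictMono p := strictMono_nat_of_lt_succ fun k => hN (p k) k
  let v : ℕ → Std A := fun k => x (p k) k
  have hvs : ∀ k, restr A (Set.Ico (p k) (p (k + 1))) (v k) = v k := fun k => hxs (p k) k
  have hsum : Summable fun k => ‖F (v k)‖ * ‖v k‖ := by
    refine Summable.of_nonneg_of_le (fun k => by positivity) (fun k => ?_)
      (summable_geometric_of_lt_one (r := (1 / 2 : ℝ)) (by norm_num) (by norm_num))
    calc ‖F (v k)‖ * ‖v k‖ ≤ (1 / 2) ^ k * 1 := by
          gcongr
          · exact hFx (p k) k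
          · exact hx1 (p k) k
      _ = _ := mul_one _
  obtain ⟨K, hK, hKsum⟩ := exists_compact_hasSum hsum
  let y : ℕ → Std A := fun k => op (a (p k) k) • v k
  have horth : ∀ j k, j ≠ k → Std.ip (v j) (v k) = 0 := fun j k hjk => by
    have hdisj : Set.Ico (p j) (p (j + 1)) ∩ Set.Ico (p k) (p (k + 1)) = ∅ :=
      Set.disjoint_iff_inter_eq_empty.1 (hmono.monotone.pairwise_disjoint_on_Ico_succ hjk)
    rw [← hvs j, ← hvs k, ip_restr_left, restr_restr, hdisj, restr_empty, Std.ip_zero_right]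
  have hip : ∀ k, Std.ip (v k) (y k) = a (p k) k := fun k => by
    rw [Std.ip_op_smul_right]
    exact hxa (p k) k
  have hker : ∀ k, y k ∈ (F - K).toLinearMap.ker := fun k => by
    change F (y k) - K (y k) = 0
    have h1 : HasSum (fun j => rankOne (F (v j)) (v j) (y k))
        (rankOne (F (v k)) (v k) (y k)) := hasSum_single k fun j hj => by
      change op (Std.ip (v j) (y k)) • F (v j) = 0
      rw [Std.ip_op_smul_right, horth j k hj, zero_mul, op_zero, zero_smul]
    rw [(hKsum (y k)).unique h1, sub_eq_zero]
    change F (op (a (p k) k) • v k) = op (Std.ip (v k) (y k)) • F (v k)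
    rw [hip, map_smul]
  obtain ⟨n, hn⟩ := exists_tail_le_of_fg ((F - K).isClosed_ker) (h K hK) (ε := 1 / 2)
    (by norm_num)
  have h1 := hn (y n) (hker n)
  have h2 : restr A (Set.Iio n)ᶜ (y n) = y n := by
    change restr A _ (op (a (p n) n) • v n) = op (a (p n) n) • v n
    rw [map_smul]
    have hset : (Set.Iio n)ᶜ ∩ Set.Ico (p n) (p (n + 1)) = Set.Ico (p n) (p (n + 1)) :=
      Set.inter_eq_right.2 fun i hi => by simpa using (hmono.le_apply (x := n)).trans hi.1
    rw [← hvs n, restr_restr, hset]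
  rw [h2] at h1
  have h3 : y n = 0 := norm_eq_zero.1 (by linarith [norm_nonneg (y n)])
  have h4 := hip n
  rw [h3, Std.ip_zero_right] at h4
  exact ha0 _ _ h4.symm

end HilbertModule

theorem theorem3p5 {A : Type*} [CStarAlgebra A] [WStarAlgebra A]
    (F : HilbertModule.Std A →L[Aᵐᵒᵖ] HilbertModule.Std A)
    (hF : HilbertModule.IsAdjointable F) :
    HilbertModule.IsUpperSemiFredholm F ↔
      ∀ K : HilbertModule.Std A →L[Aᵐᵒᵖ] HilbertModule.Std A,
        HilbertModule.IsCompactAdjointable K →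
          (F - K).toLinearMap.ker.FG :=
  ⟨fun h _ hK => (h.boundedBelowOnTail.sub_compact hK).fg_ker (hF.sub hK.1),
    fun h => (HilbertModule.boundedBelowOnTail_of_fg_ker h).isUpperSemiFredholm hF⟩

end
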